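/- **Setting.** A \emph{Banach homogeneous group} is a real Banach space $(\mathbb M,|\cdot|)$ with a continuous, bilinear, skew-symmetric bracket satisfying the Jacobi identity, together with a decomposition $\mathbb M=H_1\oplus\cdots\oplus H_\nu$ into closed subspaces such that $[H_i,H_j]\subset H_{i+j}$ (with $H_l=\{0\}$ for $l>\nu$). It carries the group operation $xy=x+y+\sum_{m=2}^{\nu}P_m(x,y)$ given by the (finite) Baker–Campbell–Hausdorff series, $$P_m(x,y)=\sum \frac{(-1)^{k-1}}{k}\,\frac{m^{-1}}{p_1!q_1!\cdots p_k!q_k!}\;x^{\circ p_1}\circ y^{\circ q_1}\circ\cdots\circ x^{\circ p_k}\circ y^{\circ q_k},$$ the sum being over $k\ge 1$ and $p_i,q_i\in\mathbb N_0$ with $p_i+q_i\ge1$ and $\sum_i(p_i+q_i)=m$, where $u_1\circ\cdots\circ u_m=[[\cdots[u_1,u_2],\cdots],u_m]$ and $x^{\circ p}$ denotes $x$ repeated $p$ times; the unit is $0$ and $x^{-1}=-x$. It also carries the dilations $\delta_r x=\sum_i r^i\pi_i(x)$, $r>0$, where $\pi_i$ is the projection onto $H_i$. A \emph{Banach homogeneous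 norm} is $\|x\|=\max_{1\le i\le\nu}\sigma_i|\pi_i(x)|^{1/i}$, where $\sigma_i>0$, $\sigma_1=1$ are such that $\|xy\|\le\|x\|+\|y\|$ for all $x,y$; the corresponding distance is $\rho(x,y)=\|x^{-1}y\|$. A \emph{stratified group} is a finite dimensional Banach homogeneous group $\mathbb G=V_1\oplus\cdots\oplus V_s$ with $[V_1,V_j]=V_{j+1}$ for $j\ge1$ (where $V_l=\{0\}$ for $l>s$). A \emph{homogeneous distance} on $\mathbb G$ is a distance $d$ with $d(zx,zy)=d(x,y)$ and $d(\delta_rx,\delta_ry)=r\,d(x,y)$ for all $x,y,z\in\mathbb G$, $r>0$; write $d(z)=d(z,0)$ and $B(x,r)$ for its open balls. Let $\mathbb G$ be a stratified group with a homogeneous distance $d$ and a Haar measure $\mu$, and let $\mathbb M$ be a Banach homogeneous group with a Banach homogeneous norm and the corresponding distance $\rho$. Let $A\subset\mathbb G$ and $f\colon A\to\mathbb M$. * A point $x$ is a \emph{density point} of $A$ if $\mu(A\cap B(x,r))/\mu(B(x,r))\to1$ as $r\downarrow0$. * A \emph{homogeneous homomorphism} is a map $L\colon\mathbb G\to\mathbb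 M$ with $L(xy)=L(x)L(y)$ and $L(\delta_rx)=\delta_rL(x)$ for all $x,y\in\mathbb G$, $r>0$. * For $x\in A$, $f$ is \emph{h-differentiable at $x$} if there is a homogeneous homomorphism $L\colon\mathbb G\to\mathbb M$ such that $\rho\big(f(x)^{-1}f(xz),L(z)\big)/d(z)\to0$ as $xz\in A$ and $d(z)\downarrow0$. * Points $\zeta^t\in\mathbb G$, $t>0$, \emph{approximate in $A$ the direction $\zeta$ at $x$} if $x\zeta^t\in A$ for every $t>0$ and $d(\zeta^t,\delta_t\zeta)/t\to0$ as $t\downarrow0$. * For $x\in A$ and $\zeta\ne0$, $f$ is \emph{differentiable at $x$ in direction $\zeta$}, with directional derivative $\partial^+f(x,\zeta)\in\mathbb M$, if there are points approximating in $A$ the direction $\zeta$ at $x$ and, for every choice $t\mapsto\zeta^t$ of such points, $\delta_{1/t}\big(f(x)^{-1}f(x\zeta^t)\big)\to\partial^+f(x,\zeta)$ with respect to $\rho$ as $t\downarrow0$. For $\zeta=0$ we put $\partial^+f(x,0)=0$. **Theorem.** Suppose $A\subset\mathbb G$ is $\mu$-measurable, $f\colon A\to\mathbb M$ is Lipschitz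 (with respect to $d$ and $\rho$), and $x\in A$ is a density point of $A$. Then $f$ is h-differentiable at $x$ if and only if the following two properties hold: 1. $f$ is differentiable at $x$ in every direction $\zeta\in\mathbb G\setminus\{0\}$; 2. the mapping $\mathbb G\ni\zeta\mapsto\partial^+f(x,\zeta)\in\mathbb M$ is a homogeneous homomorphism. -/

import Mathlib

open scoped NNReal ENNReal Topology

noncomputable section

namespace PansuDiff

/-- A Banach Lie algebra: a real Banach space with a continuous, bilinear, skew-symmetric bracket
that satisfies the Jacobi identity. -/
structure BanachLieAlgebra (M : Type*) [NormedAddCommGroup M] [NormedSpace ℝ M] where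
  complete : CompleteSpace M
  bracket : M →L[ℝ] M →L[ℝ] M
  skew : ∀ x y, bracket x y = -bracket y x
  jacobi : ∀ x y z,
    bracket x (bracket y z) + bracket y (bracket z x) + bracket z (bracket x y) = 0

/-- The left-normed bracket `[[⋯[[x₁, x₂], x₃]⋯], xₖ]` of a list `x₁, …, xₖ`. -/
def BanachLieAlgebra.leftNormed {M : Type*} [NormedAddCommGroup M] [NormedSpace ℝ M]
    (𝔤 : BanachLieAlgebra M) : List M → M
  | [] => 0
  | a :: l => l.foldl (fun u v => 𝔤.bracket u v) a

/-- The tuples `(p₁, q₁), …, (pₖ, qₖ)` of pairs of natural numbers with `pᵢ + qᵢ ≥ 1` for all `i`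
and `∑ᵢ (pᵢ + qᵢ) = m`. -/
def dynkinIndex (m k : ℕ) : Finset (Fin k → ℕ × ℕ) :=
  (Fintype.piFinset fun _ : Fin k => Finset.range (m + 1) ×ˢ Finset.range (m + 1)).filter
    fun c => (∀ i, 1 ≤ (c i).1 + (c i).2) ∧ ∑ i, ((c i).1 + (c i).2) = m

/-- The homogeneous term of degree `m` of the Baker-Campbell-Hausdorff series, by Dynkin's formula.
The constraints on the tuples force `k ≤ m`. -/
def BanachLieAlgebra.dynkinTerm {M : Type*} [NormedAddCommGroup M] [NormedSpace ℝ M]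
    (𝔤 : BanachLieAlgebra M) (m : ℕ) (x y : M) : M :=
  ∑ k ∈ Finset.Icc 1 m, ∑ c ∈ dynkinIndex m k,
    (((-1 : ℝ) ^ (k - 1) / (k : ℝ)) *
        ((m : ℝ)⁻¹ / ∏ i, (((c i).1.factorial : ℝ) * ((c i).2.factorial : ℝ)))) •
      𝔤.leftNormed
        (List.ofFn fun i => List.replicate (c i).1 x ++ List.replicate (c i).2 y).flatten

/-- A Banach homogeneous group with `ν` layers: a Banach Lie algebra `M = H₁ ⊕ ⋯ ⊕ H_ν` that is the
direct sum of closed subspaces, with `[H_i, H_j] ⊆ H_{i+j}`, where `H_l = 0` for `l > ν`. For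
convenience the layers are indexed by all natural numbers, with `H_0 = 0`. The grading makes every
bracket of more than `ν` elements vanish. -/
structure BanachHomogeneousGroup (M : Type*) [NormedAddCommGroup M] [NormedSpace ℝ M]
    extends BanachLieAlgebra M where
  ν : ℕ
  layer : ℕ → Submodule ℝ M
  isClosed_layer : ∀ i, IsClosed (layer i : Set M)
  layer_zero : layer 0 = ⊥
  layer_of_lt : ∀ i, ν < i → layer i = ⊥
  isInternal : DirectSum.IsInternal layer
  bracket_mem : ∀ i j, ∀ x ∈ layer i, ∀ y ∈ layer j, bracket x y ∈ layer (i + j)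

namespace BanachHomogeneousGroup

variable {M : Type*} [NormedAddCommGroup M] [NormedSpace ℝ M] (S : BanachHomogeneousGroup M)

/-- The group operation: the Baker-Campbell-Hausdorff series, which is finite by nilpotence. -/
def mul (x y : M) : M :=
  x + y + ∑ m ∈ Finset.Icc 2 S.ν, S.dynkinTerm m x y

/-- The inverse for the group operation; the unit element is `0`. -/
def inv (_S : BanachHomogeneousGroup M) (x : M) : M := -x

/-- The canonical projection of `M` onto its `i`-th layer. -/
def proj (i : ℕ) : M →ₗ[ℝ] M :=
  (S.layer i).subtype ∘ₗ DirectSum.component ℝ ℕ (fun j => S.layer j) i ∘ₗ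
    (LinearEquiv.ofBijective (DirectSum.coeLinearMap S.layer) S.isInternal).symm.toLinearMap

/-- The dilation `δ_r`, which multiplies the `i`-th layer by `r ^ i`. -/
def dil (r : ℝ) (x : M) : M :=
  ∑ i ∈ Finset.Icc 1 S.ν, r ^ i • S.proj i x

/-- `‖x‖ = max {σ_i |π_i(x)| ^ (1/i) : 1 ≤ i ≤ ν}`. -/
def homNorm (σ : ℕ → ℝ≥0) (x : M) : ℝ :=
  ((Finset.Icc 1 S.ν).sup fun i => σ i * ‖S.proj i x‖₊ ^ (1 / (i : ℝ)) : ℝ≥0)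

/-- The weights `σ` define a Banach homogeneous norm: they are positive, `σ₁ = 1`, and the
function `homNorm σ` is subadditive for the group operation. -/
structure IsHomNorm (σ : ℕ → ℝ≥0) : Prop where
  pos : ∀ i, 1 ≤ i → i ≤ S.ν → 0 < σ i
  one : σ 1 = 1
  mul_le : ∀ x y, S.homNorm σ (S.mul x y) ≤ S.homNorm σ x + S.homNorm σ y

/-- The Banach homogeneous distance `ρ(x, y) = ‖x⁻¹ y‖`. -/
def homDist (σ : ℕ → ℝ≥0) (x y : M) : ℝ :=
  S.homNorm σ (S.mul (S.inv x) y)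

end BanachHomogeneousGroup

/-- A stratified group: a finite dimensional Banach homogeneous group with `[V₁, V_j] = V_{j+1}`
for all `j ≥ 1`. -/
structure StratifiedGroup (G : Type*) [NormedAddCommGroup G] [NormedSpace ℝ G]
    extends BanachHomogeneousGroup G where
  finiteDimensional : FiniteDimensional ℝ G
  span_bracket : ∀ j, 1 ≤ j →
    Submodule.span ℝ {z : G | ∃ x ∈ layer 1, ∃ y ∈ layer j, bracket x y = z} = layer (j + 1)

section Domain

variable {G : Type*} [NormedAddCommGroup G] [NormedSpace ℝ G] (S : StratifiedGroup G)

/-- A homogeneous distance: a distance on `G` that is left invariant and homogeneous with respect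
to dilations. -/
structure IsHomogeneousDist (d : G → G → ℝ) : Prop where
  eq_zero_iff : ∀ x y, d x y = 0 ↔ x = y
  symm : ∀ x y, d x y = d y x
  triangle : ∀ x y z, d x z ≤ d x y + d y z
  mul_left : ∀ z x y, d (S.mul z x) (S.mul z y) = d x y
  dil : ∀ r, 0 < r → ∀ x y, d (S.dil r x) (S.dil r y) = r * d x y

/-- A (left) Haar measure on `G`: a left invariant Borel measure that is finite on compact sets and
positive on nonempty open sets. -/
structure IsHaar [MeasurableSpace G] (μ : MeasureTheory.Measure G) : Prop where
  finite_of_isCompact : ∀ K : Set G, IsCompact K → μ K < ∞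
  pos_of_isOpen : ∀ U : Set G, IsOpen U → U.Nonempty → 0 < μ U
  preimage_mul_left : ∀ (g : G) (E : Set G), MeasurableSet E → μ {y | S.mul g y ∈ E} = μ E

/-- `x` is a density point of `A`, with respect to the measure `μ` and the open balls of `d`. -/
def IsDensityPoint [MeasurableSpace G] (μ : MeasureTheory.Measure G) (d : G → G → ℝ)
    (A : Set G) (x : G) : Prop :=
  Filter.Tendsto (fun r : ℝ => μ (A ∩ {y | d x y < r}) / μ {y | d x y < r}) (𝓝[>] 0) (𝓝 1)

/-- The points `c t`, for `t > 0`, approximate in `A` the direction `ζ` at the point `x`. -/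
def Approximates (d : G → G → ℝ) (A : Set G) (x ζ : G) (c : ℝ → G) : Prop :=
  (∀ t, 0 < t → S.mul x (c t) ∈ A) ∧
    Filter.Tendsto (fun t : ℝ => d (c t) (S.dil t ζ) / t) (𝓝[>] 0) (𝓝 0)

variable {M : Type*} [NormedAddCommGroup M] [NormedSpace ℝ M] (T : BanachHomogeneousGroup M)

/-- A homogeneous homomorphism from `G` to `M`. -/
structure IsHHom (L : G → M) : Prop where
  map_mul : ∀ x y, L (S.mul x y) = T.mul (L x) (L y)
  map_dil : ∀ r, 0 < r → ∀ x, L (S.dil r x) = T.dil r (L x)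

/-- `f` is Lipschitz on `A`, with respect to `d` and the Banach homogeneous distance of `M`. -/
def LipschitzOnSet (σ : ℕ → ℝ≥0) (d : G → G → ℝ) (A : Set G) (f : G → M) : Prop :=
  ∃ C : ℝ, ∀ x ∈ A, ∀ y ∈ A, T.homDist σ (f x) (f y) ≤ C * d x y

/-- `f : A → M` (only the values of `f` on `A` matter) is differentiable at `x` in direction `ζ`
with directional derivative `v`: there are points that approximate in `A` the direction `ζ` at `x`,
and `δ_{1/t} (f(x)⁻¹ f(x c(t))) → v` as `t ↓ 0` for every choice `c` of such points. -/
def HasDirDeriv (σ : ℕ → ℝ≥0) (d : G → G → ℝ) (A : Set G) (f : G → M) (x ζ : G) (v : M) : Prop :=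
  (∃ c, Approximates S d A x ζ c) ∧
    ∀ c, Approximates S d A x ζ c →
      Filter.Tendsto
        (fun t : ℝ => T.homDist σ (T.dil (1 / t) (T.mul (T.inv (f x)) (f (S.mul x (c t))))) v)
        (𝓝[>] 0) (𝓝 0)

open Classical in
/-- The directional derivative `∂⁺f(x, ζ)`, with `∂⁺f(x, 0) = 0`. -/
def dirDeriv (σ : ℕ → ℝ≥0) (d : G → G → ℝ) (A : Set G) (f : G → M) (x ζ : G) : M :=
  if ζ = 0 then 0
  else if h : ∃ v, HasDirDeriv S T σ d A f x ζ v then h.choose else 0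

/-- `f : A → M` (only the values of `f` on `A` matter) is h-differentiable at `x`: for some
homogeneous homomorphism `L`, `ρ(f(x)⁻¹ f(xz), L(z)) / d(z) → 0` as `xz ∈ A` and `d(z) ↓ 0`. -/
def HDifferentiableAt (σ : ℕ → ℝ≥0) (d : G → G → ℝ) (A : Set G) (f : G → M) (x : G) : Prop :=
  ∃ L : G → M, IsHHom S T L ∧
    Filter.Tendsto
      (fun z : G => T.homDist σ (T.mul (T.inv (f x)) (f (S.mul x z))) (L z) / d z 0)
      (Filter.comap (fun z : G => d z 0) (𝓝[>] 0) ⊓ Filter.principal {z | S.mul x z ∈ A}) (𝓝 0)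

end Domain

end PansuDiff

end

/-!
The theorem rests on two facts that are independent of differentiability.

*The group operation of a graded Lie algebra is associative.* Dynkin's formula is first proved in
an associative `ℚ`-algebra with a nilpotent filtration. For `X = t x` and `Y = t y` in the polynomial
ring over that algebra, the Euler derivation `t d/dt` fixes `X` and `Y`. The derivative of
`Z = log (exp X exp Y)` is therefore `log T / (T - 1)` applied to `exp (-Y) X exp Y + Y`, where `T`
is the conjugation `c ↦ exp (-Y) exp (-X) c exp X exp Y`
(`leibniz_nilLog_exp_mul_exp`); this needs only the divided difference of the logarithm in two
commuting variables (`log_divided_difference`), obtained by formal integration over a segment. As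
`T` is the product of the exponentials of the right adjoint actions of `Y` and `X`, expanding gives
left-normed commutators of words in `X` and `Y`, so that comparing coefficients of `t ^ m` gives
Dynkin's term of degree `m` (`nilLog_exp_mul_exp`). A Banach homogeneous group `M` embeds into the
endomorphisms of `M × ℝ`, by its adjoint representation extended by the degree derivation, which is
faithful because all degrees are positive. Associativity is pulled back along this embedding
(`BanachHomogeneousGroup.mul_assoc`).

*Homogeneous subadditive functions on a finite dimensional graded group are controlled by the
homogeneous norm* (`IsGauge.le_homNorm`). On a line inside a layer such a function is determined by
homogeneity, and every element is a product of boundedly many factors on such lines, which depend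
continuously on it (`IsGauge.exists_isTame`). Applied to `z ↦ d z 0`, this shows that a homogeneous
distance is continuous and has compact closed balls, hence that a Haar measure is doubling. Applied
to `z ↦ ‖L z‖`, it shows that homogeneous homomorphisms are Lipschitz.

If `f` is h-differentiable at `x` with differential `L`, doubling and density provide approximating
points in every direction (`IsDensityPoint.exists_approximates`), and since `L` is Lipschitz the
directional derivative along `ζ` is `L ζ`. Conversely, if the directional derivatives form a
homogeneous homomorphism, a finite net of the unit sphere and the Lipschitz bounds for `f` and `L`
make the convergence uniform in the direction (`hDiff_of_hasDirDeriv`).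
-/

/-! ### Exponential and logarithm of nilpotent elements -/

namespace PansuDiff

section NilpotentLog

variable {A : Type*} [Ring A] [Algebra ℚ A]

/-- The logarithm `log (1 + u)` of a unipotent element of a `ℚ`-algebra. The value is meaningful
only for nilpotent `u`, when the sum runs over all nonzero terms of the series. -/
noncomputable def nilLog (u : A) : A :=
  ∑ k ∈ Finset.range (nilpotencyClass u), ((-1 : ℚ) ^ k / (k + 1)) • u ^ (k + 1)

theorem nilLog_eq_sum {u : A} {N : ℕ} (h : u ^ N = 0) :
    nilLog u = ∑ k ∈ Finset.range N, ((-1 : ℚ) ^ k / (k + 1)) • u ^ (k + 1) := by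
  have hle : nilpotencyClass u ≤ N := csInf_le' h
  refine Finset.sum_subset (Finset.range_mono hle) fun k _ hk => ?_
  rw [pow_eq_zero_of_le (n := k + 1) (m := nilpotencyClass u) (by simp at hk; omega)
    (pow_nilpotencyClass ⟨N, h⟩), smul_zero]

theorem map_nilLog {B : Type*} [Ring B] [Algebra ℚ B] (φ : A →+* B) {u : A}
    (hu : IsNilpotent u) : φ (nilLog u) = nilLog (φ u) := by
  obtain ⟨N, hN⟩ := hu
  have hN' : φ u ^ N = 0 := by rw [← map_pow, hN, map_zero]
  simp [nilLog_eq_sum hN, nilLog_eq_sum hN', map_rat_smul]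

theorem neg_pow_eq_smul (a : A) (n : ℕ) : (-a) ^ n = ((-1 : ℚ) ^ n) • a ^ n := by
  rw [neg_pow, Algebra.smul_def]
  simp

/-- A derivation of a noncommutative ring satisfies the usual power rule on elements that commute
with their derivative. -/
theorem leibniz_pow_succ (D : A →+ A) (hD : ∀ a b, D (a * b) = D a * b + a * D b)
    {a : A} (h : Commute a (D a)) (n : ℕ) : D (a ^ (n + 1)) = (n + 1 : ℚ) • (a ^ n * D a) := by
  induction n with
  | zero => simp
  | succ n ih =>
    rw [pow_succ, hD, ih, smul_mul_assoc, mul_assoc, ← h.eq, ← mul_assoc, ← pow_succ]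
    push_cast
    module

theorem leibniz_exp (D : A →+ A) (hD : ∀ a b, D (a * b) = D a * b + a * D b)
    {a : A} (h : Commute a (D a)) (ha : IsNilpotent a) :
    D (IsNilpotent.exp a) = IsNilpotent.exp a * D a := by
  obtain ⟨N, hN⟩ := ha
  have hN' : a ^ (N + 1) = 0 := by rw [pow_succ, hN, zero_mul]
  have h1 : D 1 = 0 := by simpa using hD 1 1
  have h2 : ∀ i : ℕ, D (((i + 1).factorial : ℚ)⁻¹ • a ^ (i + 1)) =
      ((i.factorial : ℚ)⁻¹ • a ^ i) * D a := fun i => by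
    rw [map_rat_smul, leibniz_pow_succ D hD h, smul_smul, smul_mul_assoc, Nat.factorial_succ]
    congr 1
    push_cast
    have : (i.factorial : ℚ) ≠ 0 := by positivity
    field_simp
  conv_lhs => rw [IsNilpotent.exp_eq_sum hN', Finset.sum_range_succ', map_add, map_sum]
  rw [IsNilpotent.exp_eq_sum hN, Finset.sum_mul]
  simp [h1, h2]

end NilpotentLog

section FormalIntegral

open Polynomial

variable {A : Type*} [Ring A]

/-- Evaluation of a polynomial at `1`, as a ring homomorphism. -/
noncomputable def evalOne : A[X] →+* A :=
  eval₂RingHom' (RingHom.id A) 1 fun a => Commute.one_right a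

theorem evalOne_apply (p : A[X]) : evalOne p = p.eval 1 := rfl

/-- Evaluation of a polynomial at `0`, as a ring homomorphism. -/
noncomputable def evalZero : A[X] →+* A :=
  eval₂RingHom' (RingHom.id A) 0 fun a => Commute.zero_right a

theorem evalZero_apply (p : A[X]) : evalZero p = p.eval 0 := rfl

theorem isNilpotent_C_mul_X {u : A} (hu : IsNilpotent u) : IsNilpotent (C u * X) := by
  obtain ⟨N, hN⟩ := hu
  exact ⟨N, by rw [(commute_X (C u)).symm.mul_pow, ← C_pow, hN, C_0, zero_mul]⟩

variable [Algebra ℚ A]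

/-- The formal integral `∫₀¹ p(s) ds` of a polynomial with coefficients in a `ℚ`-algebra. -/
noncomputable def unitIntegral : A[X] →+ A where
  toFun p := p.sum fun n c => ((n : ℚ) + 1)⁻¹ • c
  map_zero' := by simp
  map_add' p q := Polynomial.sum_add_index p q _ (by simp) (by simp)

theorem unitIntegral_monomial (n : ℕ) (c : A) :
    unitIntegral (monomial n c) = ((n : ℚ) + 1)⁻¹ • c := by
  simp [unitIntegral, Polynomial.sum_monomial_index]

theorem unitIntegral_C_mul (c : A) (p : A[X]) : unitIntegral (C c * p) = c * unitIntegral p := by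
  induction p using Polynomial.induction_on' with
  | add p q hp hq => rw [mul_add, map_add, map_add, hp, hq, mul_add]
  | monomial n a => rw [C_mul_monomial, unitIntegral_monomial, unitIntegral_monomial,
      mul_smul_comm]

theorem unitIntegral_derivative (p : A[X]) :
    unitIntegral (derivative p) = p.eval 1 - p.eval 0 := by
  induction p using Polynomial.induction_on' with
  | add p q hp hq => rw [derivative_add, map_add, hp, hq, eval_add, eval_add]; abel
  | monomial n a =>
    rw [derivative_monomial, unitIntegral_monomial, eval_monomial, eval_monomial, one_pow, mul_one]
    rcases n with _ | n
    · simp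
    · have : (n : ℚ) + 1 ≠ 0 := by positivity
      rw [← Nat.cast_comm, ← nsmul_eq_mul, ← Nat.cast_smul_eq_nsmul ℚ, smul_smul]
      simp [inv_mul_cancel₀ this]

theorem isNilpotent_nilLog {u : A} (hu : IsNilpotent u) : IsNilpotent (nilLog u) := by
  refine Commute.isNilpotent_sum (fun k _ => (hu.pow_of_pos (Nat.succ_ne_zero k)).smul _)
    fun i j _ _ => ?_
  exact ((Commute.pow_pow_self u _ _).smul_left _).smul_right _

/-- The exponential inverts the logarithm: `exp (-log (1 + su)) (1 + su)` has derivative zero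
in `s`, so its values at `s = 0` and `s = 1` agree. -/
theorem exp_nilLog {u : A} (hu : IsNilpotent u) : IsNilpotent.exp (nilLog u) = 1 + u := by
  set v : A[X] := C u * X with hv
  have hvn : IsNilpotent v := isNilpotent_C_mul_X hu
  obtain ⟨N, hN⟩ := id hvn
  let D : A[X] →+ A[X] := (derivative : A[X] →ₗ[A] A[X]).toAddMonoidHom
  have hD : ∀ a b, D (a * b) = D a * b + a * D b := fun a b => derivative_mul
  have hDv : D v = C u := derivative_C_mul_X u
  have hvu : Commute v (C u) := (Commute.refl (C u)).mul_left (commute_X (C u))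
  -- `g = log (1 + s u)`, with `s` the polynomial variable.
  set g := nilLog v with hg
  have hgn : IsNilpotent g := isNilpotent_nilLog hvn
  have hDg : D g = (∑ k ∈ Finset.range N, (-v) ^ k) * C u := by
    rw [hg, nilLog_eq_sum hN, map_sum, Finset.sum_mul]
    refine Finset.sum_congr rfl fun k _ => ?_
    have hk : (k : ℚ) + 1 ≠ 0 := by positivity
    rw [map_rat_smul, leibniz_pow_succ D hD (by rw [hDv]; exact hvu), hDv, smul_smul,
      div_mul_cancel₀ _ hk, neg_pow_eq_smul v, smul_mul_assoc]
  have hgeom : (∑ k ∈ Finset.range N, (-v) ^ k) * (1 + v) = 1 := by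
    have := geom_sum_mul_neg (-v) N
    rwa [sub_neg_eq_add, neg_pow v N, hN, mul_zero, sub_zero] at this
  have hvg : ∀ w, Commute v w → Commute g w := fun w hw => by
    rw [hg, nilLog_eq_sum hN]
    exact Commute.sum_left _ _ _ fun k _ => (hw.pow_left _).smul_left _
  have hDg1 : D g * (1 + v) = C u := by
    rw [hDg, mul_assoc, ← ((Commute.one_left (C u)).add_left hvu).eq, ← mul_assoc, hgeom, one_mul]
  have hgDg : Commute g (D g) := by
    refine hvg _ ?_
    rw [hDg]
    refine (Commute.sum_right _ _ _ fun k _ => ?_).mul_right hvu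
    exact ((Commute.refl v).neg_right).pow_right k
  have hcomm : Commute (-g) (D (-g)) := by
    rw [map_neg]; exact hgDg.neg_left.neg_right
  have hD0 : D (IsNilpotent.exp (-g) * (1 + v)) = 0 := by
    rw [hD, leibniz_exp D hD hcomm hgn.neg, map_add, hDv, map_neg, mul_assoc, neg_mul, hDg1]
    have : D 1 = 0 := derivative_one
    rw [this, zero_add, mul_neg, neg_add_cancel]
  have hI := unitIntegral_derivative (IsNilpotent.exp (-g) * (1 + v))
  have hD0' : derivative (IsNilpotent.exp (-g) * (1 + v)) = 0 := hD0
  rw [hD0', map_zero, ← evalOne_apply, ← evalZero_apply, map_mul, map_mul,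
    IsNilpotent.map_exp hgn.neg, IsNilpotent.map_exp hgn.neg, map_neg, map_neg, hg,
    map_nilLog _ hvn, map_nilLog _ hvn, map_add, map_add, map_one, map_one] at hI
  have h1 : evalOne v = u := by simp [evalOne_apply, hv]
  have h0 : evalZero v = 0 := by simp [evalZero_apply, hv]
  have hl0 : nilLog (0 : A) = 0 := by
    rw [nilLog_eq_sum (pow_one 0)]; simp
  rw [h1, h0, hl0, neg_zero, IsNilpotent.exp_zero, add_zero, mul_one] at hI
  have hI' : IsNilpotent.exp (-nilLog u) * (1 + u) = 1 := (sub_eq_zero.mp hI.symm)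
  have hn := IsNilpotent.exp_mul_exp_neg_self (isNilpotent_nilLog hu)
  calc IsNilpotent.exp (nilLog u)
      = IsNilpotent.exp (nilLog u) * (IsNilpotent.exp (-nilLog u) * (1 + u)) := by
        rw [hI', mul_one]
    _ = 1 + u := by rw [← mul_assoc, hn, one_mul]

/-- `∫₀¹ (a + s (b - a))ⁿ ds = (∑_{i+j=n} aⁱ bʲ) / (n + 1)` for commuting `a` and `b`. -/
theorem unitIntegral_segment_pow {a b : A} (h : Commute a b) (n : ℕ) :
    ((n : ℚ) + 1) • unitIntegral ((C a + C (b - a) * X) ^ n) =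
      ∑ ij ∈ Finset.HasAntidiagonal.antidiagonal n, a ^ ij.1 * b ^ ij.2 := by
  set q : A[X] := C a + C (b - a) * X with hq
  have hab : Commute a (b - a) := h.sub_right (Commute.refl a)
  let D : A[X] →+ A[X] := (derivative : A[X] →ₗ[A] A[X]).toAddMonoidHom
  have hD : ∀ a b, D (a * b) = D a * b + a * D b := fun a b => derivative_mul
  have hDq : D q = C (b - a) := by
    change derivative q = _
    simp [hq]
  have hCC : Commute (C a) (C (b - a)) := hab.map C
  have hqc : Commute q (D q) := by
    rw [hDq]
    exact hCC.add_left ((Commute.refl _).mul_left (commute_X _))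
  have hqa : Commute q (C a) :=
    (Commute.refl _).add_left (hCC.symm.mul_left (commute_X _))
  induction n with
  | zero =>
    have := unitIntegral_monomial 0 (1 : A)
    simpa using this
  | succ n ih =>
    -- Integrating the derivative of `s q ^ (n + 1)` gives the recursion of the sums on the right.
    have hder : derivative (X * q ^ (n + 1)) =
        ((n : ℚ) + 2) • q ^ (n + 1) - ((n : ℚ) + 1) • (C a * q ^ n) := by
      have h1 : derivative (q ^ (n + 1)) = ((n : ℚ) + 1) • (q ^ n * C (b - a)) := by
        have := leibniz_pow_succ D hD hqc n
        rw [hDq] at this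
        exact this
      have h2 : X * (q ^ n * C (b - a)) = q ^ n * q - C a * q ^ n := by
        rw [← (hqa.pow_left n).eq, ← mul_sub, ← mul_assoc, (commute_X (q ^ n)).eq, mul_assoc,
          (commute_X (C (b - a))).eq, hq, add_sub_cancel_left]
      rw [derivative_mul, derivative_X, one_mul, h1, mul_smul_comm, h2, ← pow_succ]
      module
    have hint := unitIntegral_derivative (X * q ^ (n + 1))
    rw [hder, map_sub, map_rat_smul, map_rat_smul, unitIntegral_C_mul, ← mul_smul_comm, ih,
      ← evalOne_apply, ← evalZero_apply, map_mul evalOne, map_mul evalZero,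
      map_pow evalOne, map_pow evalZero] at hint
    have e1 : evalOne q = b := by simp [evalOne_apply, hq]
    have e2 : evalOne (X : A[X]) = 1 := by simp [evalOne_apply]
    have e3 : evalZero (X : A[X]) = 0 := by simp [evalZero_apply]
    rw [e1, e2, e3, zero_mul, one_mul, sub_zero, sub_eq_iff_eq_add] at hint
    rw [Finset.Nat.sum_antidiagonal_succ]
    simp only [pow_zero, one_mul, pow_succ' a, mul_assoc]
    rw [← Finset.mul_sum, ← hint]
    push_cast
    congr 1
    ring

/-- The divided difference of `log (1 + ·)` between commuting nilpotent elements `a` and `b`,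
where `1 + w = (1 + b) / (1 + a)`. Both sides are `∫₀¹ (1 + a) / (1 + a + s (b - a)) ds`. -/
theorem log_divided_difference {a b w : A} (hab : Commute a b) (haw : Commute a w)
    (ha : IsNilpotent a) (hb : IsNilpotent b) (hw : IsNilpotent w)
    (h : (1 + a) * w = b - a) :
    ∃ N₀, ∀ N, N₀ ≤ N →
      (1 + a) * ∑ n ∈ Finset.range N, ((-1 : ℚ) ^ n / (n + 1)) •
        ∑ ij ∈ Finset.HasAntidiagonal.antidiagonal n, a ^ ij.1 * b ^ ij.2 =
      ∑ n ∈ Finset.range N, ((-1 : ℚ) ^ n / (n + 1)) • w ^ n := by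
  set q : A[X] := C a + C (b - a) * X with hq
  have hab' : Commute a (b - a) := hab.sub_right (Commute.refl a)
  have hqn : IsNilpotent q := by
    refine Commute.isNilpotent_add ?_ (ha.map C)
      (isNilpotent_C_mul_X (hab.symm.isNilpotent_sub hb ha))
    exact (hab'.map C).mul_right (commute_X _).symm
  obtain ⟨N₁, h₁⟩ := hqn
  obtain ⟨N₂, h₂⟩ := isNilpotent_C_mul_X hw
  refine ⟨max N₁ N₂, fun N hN => ?_⟩
  have hqN : q ^ N = 0 := pow_eq_zero_of_le (le_trans (le_max_left _ _) hN) h₁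
  have hwN : (C w * X) ^ N = 0 := pow_eq_zero_of_le (le_trans (le_max_right _ _) hN) h₂
  have hfac : 1 + q = C (1 + a) * (1 + C w * X) := by
    rw [mul_add, mul_one, ← mul_assoc, ← C_mul, h, C_add, C_1, hq, add_assoc]
  have hcomm : Commute (C (1 + a)) (1 + C w * X) := by
    refine (Commute.one_right _).add_right (Commute.mul_right ?_ (commute_X _).symm)
    exact ((Commute.one_left _).add_left haw).map C
  have g1 : (1 + q) * ∑ n ∈ Finset.range N, (-q) ^ n = 1 := by
    have := mul_neg_geom_sum (-q) N
    rwa [sub_neg_eq_add, neg_pow q N, hqN, mul_zero, sub_zero] at this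
  have g2 : (∑ n ∈ Finset.range N, (-(C w * X)) ^ n) * (1 + C w * X) = 1 := by
    have := geom_sum_mul_neg (-(C w * X)) N
    rwa [sub_neg_eq_add, neg_pow (C w * X) N, hwN, mul_zero, sub_zero] at this
  have key : C (1 + a) * ∑ n ∈ Finset.range N, (-q) ^ n =
      ∑ n ∈ Finset.range N, (-(C w * X)) ^ n := by
    rw [hfac, hcomm.eq, mul_assoc] at g1
    calc C (1 + a) * ∑ n ∈ Finset.range N, (-q) ^ n
        = ((∑ n ∈ Finset.range N, (-(C w * X)) ^ n) * (1 + C w * X)) *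
          (C (1 + a) * ∑ n ∈ Finset.range N, (-q) ^ n) := by rw [g2, one_mul]
      _ = _ := by rw [mul_assoc, g1, mul_one]
  have hI := congrArg unitIntegral key
  rw [unitIntegral_C_mul, map_sum, map_sum] at hI
  convert hI using 2
  · refine Finset.sum_congr rfl fun n _ => ?_
    have hn : (n : ℚ) + 1 ≠ 0 := by positivity
    rw [neg_pow_eq_smul q, map_rat_smul, ← unitIntegral_segment_pow hab, smul_smul, div_mul_cancel₀ _ hn]
  · rename_i n _
    rw [neg_pow_eq_smul (C w * X), map_rat_smul, (commute_X (C w)).symm.mul_pow, ← C_pow, C_mul_X_pow_eq_monomial,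
      unitIntegral_monomial, smul_smul, div_eq_mul_inv]

end FormalIntegral

end PansuDiff

/-! ### Dynkin's expansion of the derivative of the logarithm -/

namespace PansuDiff

section CommutatorWords

variable {A : Type*} [Ring A]

/-- The left-normed commutator `[[⋯[[a₁, a₂], a₃]⋯], aₖ]` of a list in an associative ring. -/
def commWord : List A → A
  | [] => 0
  | a :: l => l.foldl (fun u v => u * v - v * u) a

theorem commWord_append {l : List A} (hl : l ≠ []) (l' : List A) :
    commWord (l ++ l') = l'.foldl (fun u v => u * v - v * u) (commWord l) := by
  cases l with
  | nil => exact absurd rfl hl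
  | cons a l => simp [commWord, List.foldl_append]

/-- The word `x^{p₁} y^{q₁} ⋯ x^{pₖ} y^{qₖ}`, as a list of letters. -/
def dynkinWord {α : Type*} {k : ℕ} (c : Fin k → ℕ × ℕ) (x y : α) : List α :=
  (List.ofFn fun i => List.replicate (c i).1 x ++ List.replicate (c i).2 y).flatten

theorem dynkinWord_map {α β : Type*} (φ : α → β) {k : ℕ} (c : Fin k → ℕ × ℕ) (x y : α) :
    (dynkinWord c x y).map φ = dynkinWord c (φ x) (φ y) := by
  simp [dynkinWord, List.map_flatten, List.map_ofFn, Function.comp_def]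

theorem length_dynkinWord {α : Type*} {k : ℕ} (c : Fin k → ℕ × ℕ) (x y : α) :
    (dynkinWord c x y).length = ∑ i, ((c i).1 + (c i).2) := by
  simp [dynkinWord, List.length_flatten, List.map_ofFn, Function.comp_def, List.sum_ofFn]

theorem dynkinWord_snoc {α : Type*} {k : ℕ} (c : Fin k → ℕ × ℕ) (s : ℕ × ℕ) (x y : α) :
    dynkinWord (Fin.snoc c s : Fin (k + 1) → ℕ × ℕ) x y =
      dynkinWord c x y ++ (List.replicate s.1 x ++ List.replicate s.2 y) := by
  rw [dynkinWord, List.ofFn_succ', List.concat_eq_append]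
  simp [dynkinWord]

/-- The reciprocal of `p₁! q₁! ⋯ pₖ! qₖ!`. -/
noncomputable def dynkinWeight {k : ℕ} (c : Fin k → ℕ × ℕ) : ℚ :=
  ∏ i, (((c i).1.factorial : ℚ)⁻¹ * ((c i).2.factorial : ℚ)⁻¹)

theorem dynkinWeight_snoc {k : ℕ} (c : Fin k → ℕ × ℕ) (s : ℕ × ℕ) :
    dynkinWeight (Fin.snoc c s : Fin (k + 1) → ℕ × ℕ) =
      dynkinWeight c * ((s.1.factorial : ℚ)⁻¹ * (s.2.factorial : ℚ)⁻¹) := by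
  simp [dynkinWeight, Fin.prod_univ_castSucc]

/-- The pairs `(p, q) ≠ (0, 0)` with `p, q < B`. -/
def pairBox (B : ℕ) : Finset (ℕ × ℕ) := (Finset.range B ×ˢ Finset.range B).erase (0, 0)

theorem sum_piFinset_snoc {β : Type*} [AddCommMonoid β] {k : ℕ} (S : Finset (ℕ × ℕ))
    (g : (Fin (k + 1) → ℕ × ℕ) → β) :
    ∑ c ∈ Fintype.piFinset (fun _ : Fin (k + 1) => S), g c =
      ∑ s ∈ S, ∑ c ∈ Fintype.piFinset (fun _ : Fin k => S), g (Fin.snoc c s) := by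
  rw [← Finset.sum_product']
  refine Finset.sum_nbij' (fun c => (c (Fin.last k), Fin.init c)) (fun p => Fin.snoc p.2 p.1)
    ?_ ?_ ?_ ?_ ?_
  · intro c hc
    simp only [Fintype.mem_piFinset, Finset.mem_product] at hc ⊢
    exact ⟨hc _, fun i => hc _⟩
  · rintro ⟨s, c⟩ hc
    simp only [Fintype.mem_piFinset, Finset.mem_product] at hc ⊢
    intro i
    refine Fin.lastCases ?_ (fun j => ?_) i
    · simpa using hc.1
    · simpa using hc.2 j
  · intro c _
    simp
  · rintro ⟨s, c⟩ _
    simp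
  · intro c _
    simp

end CommutatorWords

section DynkinDerivation

variable {A : Type*} [Ring A] [Algebra ℚ A]

/-- The right adjoint action `c ↦ [c, v]`. -/
noncomputable def adRight (v : A) : Module.End ℚ A := LinearMap.mulRight ℚ v - LinearMap.mulLeft ℚ v

theorem adRight_apply (v c : A) : adRight v c = c * v - v * c := rfl

theorem isNilpotent_mulLeft {v : A} (hv : IsNilpotent v) :
    IsNilpotent (LinearMap.mulLeft ℚ v) := by
  obtain ⟨N, hN⟩ := hv
  exact ⟨N, by rw [LinearMap.pow_mulLeft, hN, LinearMap.mulLeft_zero_eq_zero]⟩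

theorem isNilpotent_mulRight {v : A} (hv : IsNilpotent v) :
    IsNilpotent (LinearMap.mulRight ℚ v) := by
  obtain ⟨N, hN⟩ := hv
  exact ⟨N, by rw [LinearMap.pow_mulRight, hN, LinearMap.mulRight_zero_eq_zero]⟩

theorem commute_mulLeft_mulRight (v w : A) :
    Commute (LinearMap.mulLeft ℚ v) (LinearMap.mulRight ℚ w) := by
  ext c
  simp [mul_assoc]

theorem isNilpotent_adRight {v : A} (hv : IsNilpotent v) : IsNilpotent (adRight v) :=
  (commute_mulLeft_mulRight v v).symm.isNilpotent_sub (isNilpotent_mulRight hv)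
    (isNilpotent_mulLeft hv)

theorem exp_mulLeft_apply {v : A} (hv : IsNilpotent v) (c : A) :
    IsNilpotent.exp (LinearMap.mulLeft ℚ v) c = IsNilpotent.exp v * c := by
  obtain ⟨N, hN⟩ := hv
  have h : LinearMap.mulLeft ℚ v ^ N = 0 := by
    rw [LinearMap.pow_mulLeft, hN, LinearMap.mulLeft_zero_eq_zero]
  rw [IsNilpotent.exp_eq_sum hN, IsNilpotent.exp_eq_sum h, Finset.sum_mul, LinearMap.sum_apply]
  simp [LinearMap.pow_mulLeft]

theorem exp_mulRight_apply {v : A} (hv : IsNilpotent v) (c : A) :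
    IsNilpotent.exp (LinearMap.mulRight ℚ v) c = c * IsNilpotent.exp v := by
  obtain ⟨N, hN⟩ := hv
  have h : LinearMap.mulRight ℚ v ^ N = 0 := by
    rw [LinearMap.pow_mulRight, hN, LinearMap.mulRight_zero_eq_zero]
  rw [IsNilpotent.exp_eq_sum hN, IsNilpotent.exp_eq_sum h, Finset.mul_sum, LinearMap.sum_apply]
  simp [LinearMap.pow_mulRight]

theorem exp_adRight_apply {v : A} (hv : IsNilpotent v) (c : A) :
    IsNilpotent.exp (adRight v) c = IsNilpotent.exp (-v) * c * IsNilpotent.exp v := by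
  have h : adRight v = LinearMap.mulRight ℚ v + LinearMap.mulLeft ℚ (-v) := by
    ext c
    simp [adRight_apply, sub_eq_add_neg]
  rw [h, IsNilpotent.exp_add_of_commute (commute_mulLeft_mulRight _ _).symm
    (isNilpotent_mulRight hv) (isNilpotent_mulLeft hv.neg), Module.End.mul_apply,
    exp_mulLeft_apply hv.neg, exp_mulRight_apply hv]

theorem leibniz_pow_antidiagonal (D : A →+ A) (hD : ∀ a b, D (a * b) = D a * b + a * D b)
    (u : A) (n : ℕ) :
    D (u ^ (n + 1)) = (∑ ij ∈ Finset.HasAntidiagonal.antidiagonal n,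
      LinearMap.mulLeft ℚ u ^ ij.1 * LinearMap.mulRight ℚ u ^ ij.2) (D u) := by
  induction n with
  | zero => simp
  | succ n ih =>
    rw [pow_succ', hD, ih, Finset.Nat.sum_antidiagonal_succ]
    simp only [LinearMap.sum_apply, LinearMap.add_apply, Module.End.mul_apply,
      LinearMap.pow_mulLeft, LinearMap.pow_mulRight, LinearMap.mulLeft_apply,
      LinearMap.mulRight_apply, pow_zero, one_mul, pow_succ' u, mul_assoc, Finset.mul_sum]

/-- If `D` is a derivation that fixes `X` and `Y`, the derivative of `log (eˣ eʸ)` is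
`log T / (T - 1)` applied to the logarithmic derivative of `eˣ eʸ`, where `T` is the
conjugation by `eˣ eʸ`. -/
theorem leibniz_nilLog_exp_mul_exp (D : A →+ A) (hD : ∀ a b, D (a * b) = D a * b + a * D b)
    {X Y : A} (hX : IsNilpotent X) (hY : IsNilpotent Y) (hDX : D X = X) (hDY : D Y = Y)
    (hu : IsNilpotent (IsNilpotent.exp X * IsNilpotent.exp Y - 1)) :
    ∃ N₀, ∀ N, N₀ ≤ N →
      D (nilLog (IsNilpotent.exp X * IsNilpotent.exp Y - 1)) =
        ∑ n ∈ Finset.range N, ((-1 : ℚ) ^ n / (n + 1)) •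
          ((IsNilpotent.exp (adRight Y) * IsNilpotent.exp (adRight X) - 1) ^ n)
            (IsNilpotent.exp (adRight Y) X + Y) := by
  set F := IsNilpotent.exp X * IsNilpotent.exp Y with hF
  set G := IsNilpotent.exp (-Y) * IsNilpotent.exp (-X) with hG
  set u := F - 1 with hudef
  have hFG : F * G = 1 := by
    rw [hF, hG, mul_assoc, ← mul_assoc (IsNilpotent.exp Y), IsNilpotent.exp_mul_exp_neg_self hY,
      one_mul, IsNilpotent.exp_mul_exp_neg_self hX]
  have hGF : G * F = 1 := by
    rw [hF, hG, mul_assoc, ← mul_assoc (IsNilpotent.exp (-X)),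
      IsNilpotent.exp_neg_mul_exp_self hX, one_mul, IsNilpotent.exp_neg_mul_exp_self hY]
  set w : Module.End ℚ A := IsNilpotent.exp (adRight Y) * IsNilpotent.exp (adRight X) - 1 with hw
  have hwc : ∀ c, w c = G * c * F - c := fun c => by
    rw [hw, LinearMap.sub_apply, Module.End.mul_apply, exp_adRight_apply hX, exp_adRight_apply hY,
      Module.End.one_apply, hG, hF]
    simp only [mul_assoc]
  set b := IsNilpotent.exp (adRight Y) X + Y with hb
  -- `b` is the logarithmic derivative of `F`.
  have hDF : D u = F * b := by
    have h1 : D 1 = 0 := by simpa using hD 1 1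
    have hXc : Commute X (D X) := by rw [hDX]
    have hYc : Commute Y (D Y) := by rw [hDY]
    rw [hudef, map_sub, h1, sub_zero, hF, hD, leibniz_exp D hD hXc hX, leibniz_exp D hD hYc hY,
      hDX, hDY, hb, exp_adRight_apply hY, mul_add]
    congr 1
    · rw [mul_assoc (IsNilpotent.exp X), mul_assoc (IsNilpotent.exp X), ← mul_assoc, ← mul_assoc,
        ← mul_assoc, ← mul_assoc, mul_assoc (IsNilpotent.exp X) (IsNilpotent.exp Y),
        IsNilpotent.exp_mul_exp_neg_self hY, mul_one]
    · rw [mul_assoc]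
  have h1a : ∀ c, (1 + LinearMap.mulLeft ℚ u) c = F * c := fun c => by
    simp [hudef, sub_mul]
  have hGu : G * u = u * G := by rw [hudef, mul_sub, sub_mul, hGF, hFG, mul_one, one_mul]
  have hab := commute_mulLeft_mulRight u u
  have haw : Commute (LinearMap.mulLeft ℚ u) w := by
    ext c
    simp only [Module.End.mul_apply, hwc, LinearMap.mulLeft_apply, mul_sub]
    rw [← mul_assoc G, hGu]
    simp only [mul_assoc]
  -- As `T = L⁻¹ R` for the left and right multiplications `L` and `R` by `F`, the logarithm's
  -- divided difference at `u` on the left and `u` on the right is a series in `w = T - 1`.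
  have hmul : (1 + LinearMap.mulLeft ℚ u) * w = LinearMap.mulRight ℚ u - LinearMap.mulLeft ℚ u := by
    ext c
    rw [Module.End.mul_apply, h1a, hwc, mul_sub, mul_assoc G c F, ← mul_assoc F G, hFG, one_mul,
      LinearMap.sub_apply, LinearMap.mulLeft_apply, LinearMap.mulRight_apply, hudef]
    noncomm_ring
  have hwn : IsNilpotent w := by
    have hw' : w = LinearMap.mulLeft ℚ G * (LinearMap.mulRight ℚ u - LinearMap.mulLeft ℚ u) := by
      rw [← hmul]
      ext c
      rw [Module.End.mul_apply, Module.End.mul_apply, h1a, LinearMap.mulLeft_apply, ← mul_assoc,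
        hGF, one_mul]
    rw [hw']
    refine Commute.isNilpotent_mul_left ?_ (hab.symm.isNilpotent_sub (isNilpotent_mulRight hu)
      (isNilpotent_mulLeft hu))
    refine (commute_mulLeft_mulRight G u).sub_right ?_
    ext c
    simp only [Module.End.mul_apply, LinearMap.mulLeft_apply, ← mul_assoc, hGu]
  obtain ⟨N₁, hN₁⟩ := log_divided_difference hab haw (isNilpotent_mulLeft hu)
    (isNilpotent_mulRight hu) hwn hmul
  obtain ⟨N₂, hN₂⟩ := hu
  refine ⟨max N₁ N₂, fun N hN => ?_⟩
  have huN : u ^ N = 0 := pow_eq_zero_of_le (le_trans (le_max_right _ _) hN) hN₂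
  have h := LinearMap.congr_fun (hN₁ N (le_trans (le_max_left _ _) hN)) b
  simp only [LinearMap.sum_apply _ _ b, LinearMap.smul_apply] at h
  rw [← h, nilLog_eq_sum huN, map_sum]
  have hc : Commute (1 + LinearMap.mulLeft ℚ u) (∑ n ∈ Finset.range N, ((-1 : ℚ) ^ n / (n + 1)) •
        ∑ ij ∈ Finset.HasAntidiagonal.antidiagonal n,
          LinearMap.mulLeft ℚ u ^ ij.1 * LinearMap.mulRight ℚ u ^ ij.2) := by
    refine (Commute.one_left _).add_left (Commute.sum_right _ _ _ fun n _ => ?_)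
    refine Commute.smul_right (Commute.sum_right _ _ _ fun ij _ => ?_) _
    exact (Commute.pow_right (Commute.refl _) _).mul_right (hab.pow_right _)
  rw [hc.eq, Module.End.mul_apply, h1a, ← hDF, LinearMap.sum_apply]
  refine Finset.sum_congr rfl fun n _ => ?_
  rw [map_rat_smul, leibniz_pow_antidiagonal D hD, LinearMap.smul_apply]

theorem foldl_replicate_comm (v : A) (p : ℕ) (c : A) :
    (List.replicate p v).foldl (fun u v => u * v - v * u) c = (adRight v ^ p) c := by
  induction p generalizing c with
  | zero => simp
  | succ p ih => rw [List.replicate_succ, List.foldl_cons, ih, pow_succ, Module.End.mul_apply,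
      adRight_apply]

/-- Appending a block `xᵖ y^q` to a word applies the corresponding right adjoint actions. -/
theorem commWord_append_pair {l : List A} (hl : l ≠ []) (X Y : A) (s : ℕ × ℕ) :
    commWord (l ++ (List.replicate s.1 X ++ List.replicate s.2 Y)) =
      (adRight Y ^ s.2 * adRight X ^ s.1) (commWord l) := by
  rw [commWord_append hl, List.foldl_append, foldl_replicate_comm, foldl_replicate_comm,
    Module.End.mul_apply]

theorem exp_adRight_mul_sub_one {X Y : A} {B : ℕ} (hB : 1 ≤ B) (hX : adRight X ^ B = 0)
    (hY : adRight Y ^ B = 0) :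
    IsNilpotent.exp (adRight Y) * IsNilpotent.exp (adRight X) - 1 =
      ∑ s ∈ pairBox B, ((s.1.factorial : ℚ)⁻¹ * (s.2.factorial : ℚ)⁻¹) •
        (adRight Y ^ s.2 * adRight X ^ s.1) := by
  have h0 : ((0, 0) : ℕ × ℕ) ∈ Finset.range B ×ˢ Finset.range B := by
    simp; omega
  rw [pairBox, Finset.sum_erase_eq_sub h0, IsNilpotent.exp_eq_sum hX, IsNilpotent.exp_eq_sum hY,
    Finset.sum_mul_sum, Finset.sum_product_right]
  simp [smul_smul, mul_comm]

theorem commWord_self_pair (X : A) : ∀ p, 2 ≤ p → commWord (List.replicate p X) = 0 := by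
  intro p hp
  obtain ⟨p, rfl⟩ := Nat.exists_eq_add_of_le' hp
  rw [List.replicate_succ, List.replicate_succ]
  have : commWord (X :: X :: List.replicate p X) = (adRight X ^ p) (X * X - X * X) := by
    rw [← foldl_replicate_comm]; rfl
  rw [this, sub_self, map_zero]

/-- Only the words `x y^q` and `y` contribute to the right-hand side. -/
theorem exp_adRight_add {X Y : A} {B : ℕ} (hB : 2 ≤ B) (hY : adRight Y ^ B = 0) :
    IsNilpotent.exp (adRight Y) X + Y =
      ∑ s ∈ pairBox B, ((s.1.factorial : ℚ)⁻¹ * (s.2.factorial : ℚ)⁻¹) •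
        commWord (List.replicate s.1 X ++ List.replicate s.2 Y) := by
  have h0 : ((0, 0) : ℕ × ℕ) ∈ Finset.range B ×ˢ Finset.range B := by
    simp; omega
  rw [pairBox, Finset.sum_erase _ (by simp [commWord]), Finset.sum_product]
  obtain ⟨B, rfl⟩ := Nat.exists_eq_add_of_le' hB
  have hlong : ∑ p ∈ Finset.range B, ∑ q ∈ Finset.range (B + 2),
      (((p + 1 + 1).factorial : ℚ)⁻¹ * (q.factorial : ℚ)⁻¹) •
        commWord (List.replicate (p + 1 + 1) X ++ List.replicate q Y) = 0 := by
    refine Finset.sum_eq_zero fun p _ => Finset.sum_eq_zero fun q _ => ?_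
    rw [commWord_append (by simp), commWord_self_pair _ _ (by omega), foldl_replicate_comm,
      map_zero, smul_zero]
  rw [Finset.sum_range_succ', Finset.sum_range_succ', hlong, zero_add]
  · congr 1
    · rw [IsNilpotent.exp_eq_sum hY, LinearMap.sum_apply]
      refine Finset.sum_congr rfl fun q _ => ?_
      rw [commWord_append (by simp), foldl_replicate_comm]
      simp [commWord]
    · rw [Finset.sum_range_succ', Finset.sum_range_succ', Finset.sum_eq_zero]
      · simp [commWord]
      · intro q _
        rw [List.replicate_zero, List.nil_append, commWord_self_pair _ _ (by omega), smul_zero]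

/-- The powers of `T - 1`, applied to the logarithmic derivative of `eˣ eʸ`, expand into the
left-normed commutators of Dynkin's formula. -/
theorem pow_apply_eq_sum_commWord {X Y : A} {B : ℕ} (hB : 2 ≤ B) (hX : adRight X ^ B = 0)
    (hY : adRight Y ^ B = 0) (k : ℕ) :
    ((IsNilpotent.exp (adRight Y) * IsNilpotent.exp (adRight X) - 1) ^ k)
        (IsNilpotent.exp (adRight Y) X + Y) =
      ∑ c ∈ Fintype.piFinset (fun _ : Fin (k + 1) => pairBox B),
        dynkinWeight c • commWord (dynkinWord c X Y) := by
  induction k with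
  | zero =>
    rw [pow_zero, Module.End.one_apply, exp_adRight_add hB hY, sum_piFinset_snoc]
    refine Finset.sum_congr rfl fun s _ => ?_
    simp only [dynkinWeight_snoc, dynkinWord_snoc]
    simp [dynkinWeight, dynkinWord]
  | succ k ih =>
    rw [pow_succ', Module.End.mul_apply, ih, exp_adRight_mul_sub_one (by omega) hX hY,
      sum_piFinset_snoc (k := k + 1), LinearMap.sum_apply]
    refine Finset.sum_congr rfl fun s _ => ?_
    rw [LinearMap.smul_apply, map_sum, Finset.smul_sum]
    refine Finset.sum_congr rfl fun c hc => ?_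
    have hne : dynkinWord c X Y ≠ [] := by
      intro h
      have hlen := congrArg List.length h
      rw [length_dynkinWord, List.length_nil, Finset.sum_eq_zero_iff] at hlen
      have h1 := hlen 0 (Finset.mem_univ _)
      have h2 := (Fintype.mem_piFinset.mp hc) 0
      simp only [pairBox, Finset.mem_erase] at h2
      exact h2.1 (Prod.ext (by simp; omega) (by simp; omega))
    rw [map_smul, dynkinWord_snoc, dynkinWeight_snoc, commWord_append_pair hne, smul_smul,
      mul_comm]

end DynkinDerivation

end PansuDiff

/-! ### The Baker-Campbell-Hausdorff formula in a filtered algebra -/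

namespace PansuDiff

section Filtration

open Polynomial

variable {A : Type*} [Ring A]

/-- The Euler derivation `t d/dt` of polynomials. -/
noncomputable def eulerPoly : A[X] →+ A[X] where
  toFun p := X * derivative p
  map_zero' := by simp
  map_add' p q := by rw [derivative_add, mul_add]

theorem eulerPoly_mul (p q : A[X]) :
    eulerPoly (p * q) = eulerPoly p * q + p * eulerPoly q := by
  change X * derivative (p * q) = X * derivative p * q + p * (X * derivative q)
  rw [derivative_mul, mul_add, ← mul_assoc, ← mul_assoc, ← mul_assoc, (commute_X p).eq]

theorem eulerPoly_C_mul_X (x : A) : eulerPoly (C x * X) = C x * X := by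
  change X * derivative (C x * X) = _
  rw [derivative_C_mul_X, (commute_X (C x)).eq]

theorem commWord_map_C_mul_X (l : List A) :
    commWord (l.map fun a => C a * X) = C (commWord l) * X ^ l.length := by
  induction l using List.reverseRecOn with
  | nil => simp [commWord]
  | append_singleton l a ih =>
    rcases eq_or_ne l [] with rfl | hl
    · simp [commWord]
    · rw [List.map_append, commWord_append (by simpa using hl), ih, commWord_append hl]
      simp only [List.map_cons, List.map_nil, List.foldl_cons, List.foldl_nil, List.length_append,
        List.length_cons, List.length_nil, zero_add, C_sub, C_mul, sub_mul]
      have h1 : ∀ (b c : A) (k : ℕ), C b * X ^ k * (C c * X) = C b * C c * X ^ (k + 1) := by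
        intro b c k
        rw [mul_assoc, ← mul_assoc (X ^ k), ((commute_X (C c)).pow_left k).eq, mul_assoc (C c),
          ← pow_succ, mul_assoc]
      have h2 : ∀ (b c : A) (k : ℕ), C c * X * (C b * X ^ k) = C c * C b * X ^ (k + 1) := by
        intro b c k
        rw [mul_assoc, ← mul_assoc X, (commute_X (C b)).eq, mul_assoc (C b), ← pow_succ',
          mul_assoc]
      rw [h1, h2]

theorem coeff_commWord_dynkinWord {k : ℕ} (c : Fin k → ℕ × ℕ) (x y : A) (m : ℕ) :
    (commWord (dynkinWord c (C x * X) (C y * X))).coeff m =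
      if ∑ i, ((c i).1 + (c i).2) = m then commWord (dynkinWord c x y) else 0 := by
  rw [← dynkinWord_map (fun a : A => C a * X), commWord_map_C_mul_X, coeff_C_mul, coeff_X_pow,
    length_dynkinWord]
  simp [eq_comm]

variable [Algebra ℚ A]

/-- A decreasing multiplicative filtration `J 0 ⊇ J 1 ⊇ ⋯` of an algebra with `J (n + 1) = 0`. The
elements of `J 1` are jointly nilpotent: any product of `n + 1` of them vanishes. -/
structure IsNilpotentFiltration (J : ℕ → Submodule ℚ A) (n : ℕ) : Prop where
  mul_mem : ∀ {i j a b}, a ∈ J i → b ∈ J j → a * b ∈ J (i + j)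
  succ_le : ∀ i, J (i + 1) ≤ J i
  eq_bot : J (n + 1) = ⊥

namespace IsNilpotentFiltration

variable {J : ℕ → Submodule ℚ A} {n : ℕ}

theorem antitone (hJ : IsNilpotentFiltration J n) : Antitone J := antitone_nat_of_succ_le hJ.succ_le

theorem eq_zero (hJ : IsNilpotentFiltration J n) {k : ℕ} (hk : n < k) {a : A} (ha : a ∈ J k) :
    a = 0 := by
  have := hJ.antitone (Nat.succ_le_of_lt hk) ha
  rwa [Nat.succ_eq_add_one, hJ.eq_bot, Submodule.mem_bot] at this

theorem pow_mem (hJ : IsNilpotentFiltration J n) {a : A} (ha : a ∈ J 1) (k : ℕ) :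
    a ^ (k + 1) ∈ J (k + 1) := by
  induction k with
  | zero => simpa using ha
  | succ k ih => rw [pow_succ]; exact hJ.mul_mem ih ha

theorem pow_eq_zero (hJ : IsNilpotentFiltration J n) {a : A} (ha : a ∈ J 1) : a ^ (n + 1) = 0 :=
  hJ.eq_zero (Nat.lt_succ_self n) (hJ.pow_mem ha n)

theorem isNilpotent (hJ : IsNilpotentFiltration J n) {a : A} (ha : a ∈ J 1) : IsNilpotent a :=
  ⟨n + 1, hJ.pow_eq_zero ha⟩

theorem exp_sub_one_mem (hJ : IsNilpotentFiltration J n) {a : A} (ha : a ∈ J 1) :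
    IsNilpotent.exp a - 1 ∈ J 1 := by
  rw [IsNilpotent.exp_eq_sum (hJ.pow_eq_zero ha), Finset.sum_range_succ']
  simp only [pow_zero, Nat.factorial_zero, Nat.cast_one, inv_one, one_smul, add_sub_cancel_right]
  exact Submodule.sum_mem _ fun k _ =>
    Submodule.smul_mem _ _ (hJ.antitone (by omega) (hJ.pow_mem ha k))

theorem mul_sub_one_mem (hJ : IsNilpotentFiltration J n) {g h : A} (hg : g - 1 ∈ J 1)
    (hh : h - 1 ∈ J 1) : g * h - 1 ∈ J 1 := by
  have : g * h - 1 = (g - 1) * (h - 1) + (g - 1) + (h - 1) := by noncomm_ring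
  rw [this]
  exact Submodule.add_mem _ (Submodule.add_mem _ (hJ.succ_le 1 (hJ.mul_mem hg hh)) hg) hh

theorem commWord_mem (hJ : IsNilpotentFiltration J n) :
    ∀ l : List A, (∀ a ∈ l, a ∈ J 1) → commWord l ∈ J l.length := by
  intro l
  induction l using List.reverseRecOn with
  | nil => intro _; exact Submodule.zero_mem _
  | append_singleton l a ih =>
    intro h
    have ha : a ∈ J 1 := h a (by simp)
    rcases eq_or_ne l [] with rfl | hl
    · simpa [commWord] using ha
    · have hm := ih fun b hb => h b (by simp [hb])
      rw [commWord_append hl, List.length_append, List.length_singleton]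
      refine Submodule.sub_mem _ (hJ.mul_mem hm ha) ?_
      rw [add_comm]
      exact hJ.mul_mem ha hm

/-- The filtration induced on polynomials by a filtration of the coefficients. -/
def poly (J : ℕ → Submodule ℚ A) (k : ℕ) : Submodule ℚ A[X] where
  carrier := {p | ∀ m, p.coeff m ∈ J k}
  add_mem' hp hq m := by rw [coeff_add]; exact Submodule.add_mem _ (hp m) (hq m)
  zero_mem' m := by rw [coeff_zero]; exact Submodule.zero_mem _
  smul_mem' r p hp m := by rw [coeff_smul]; exact Submodule.smul_mem _ r (hp m)

theorem isNilpotentFiltration_poly (hJ : IsNilpotentFiltration J n) :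
    IsNilpotentFiltration (poly J) n where
  mul_mem {i j p q} hp hq m := by
    rw [coeff_mul]
    exact Submodule.sum_mem _ fun ij _ => hJ.mul_mem (hp _) (hq _)
  succ_le i p hp m := hJ.succ_le i (hp m)
  eq_bot := by
    refine (Submodule.eq_bot_iff _).mpr fun p hp => ?_
    ext m
    exact hJ.eq_zero (Nat.lt_succ_self n) (hp m)

theorem C_mul_X_mem {x : A} (hx : x ∈ J 1) : C x * X ∈ poly J 1 := by
  intro m
  rw [coeff_C_mul_X]
  split_ifs
  · exact hx
  · exact Submodule.zero_mem _

end IsNilpotentFiltration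

theorem coeff_eulerPoly (p : A[X]) (m : ℕ) : (eulerPoly p).coeff m = (m : ℚ) • p.coeff m := by
  change (X * derivative p).coeff m = _
  cases m with
  | zero => simp
  | succ m =>
    rw [coeff_X_mul, coeff_derivative, Nat.cast_smul_eq_nsmul, nsmul_eq_mul,
      ← Nat.cast_succ, ← Nat.cast_comm]

/-- The bound on the exponents in `dynkinIndex` is immaterial, since the total degree bounds
them. -/
theorem dynkinIndex_eq_filter {B m : ℕ} (hB : m < B) (k : ℕ) :
    dynkinIndex m k = (Fintype.piFinset fun _ : Fin k => pairBox B).filter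
      fun c => ∑ i, ((c i).1 + (c i).2) = m := by
  ext c
  simp only [dynkinIndex, pairBox, Finset.mem_filter, Fintype.mem_piFinset, Finset.mem_product,
    Finset.mem_range, Finset.mem_erase, ne_eq, Prod.ext_iff]
  constructor
  · rintro ⟨h1, h2, h3⟩
    refine ⟨fun i => ⟨?_, ?_, ?_⟩, h3⟩
    · have := h2 i
      omega
    · have := (h1 i).1
      omega
    · have := (h1 i).2
      omega
  · rintro ⟨h1, h2⟩
    have hle : ∀ i, (c i).1 + (c i).2 ≤ m := fun i => by
      rw [← h2]
      exact Finset.single_le_sum (f := fun i => (c i).1 + (c i).2) (fun _ _ => Nat.zero_le _)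
        (Finset.mem_univ i)
    refine ⟨fun i => ⟨?_, ?_⟩, fun i => ?_, h2⟩
    · have := hle i
      omega
    · have := hle i
      omega
    · have := (h1 i).1
      omega

theorem dynkinIndex_eq_empty {m k : ℕ} (h : m < k) : dynkinIndex m k = ∅ := by
  refine Finset.eq_empty_of_forall_notMem fun c hc => ?_
  simp only [dynkinIndex, Finset.mem_filter] at hc
  have : ∑ _i : Fin k, 1 ≤ ∑ i, ((c i).1 + (c i).2) := Finset.sum_le_sum fun i _ => hc.2.1 i
  simp at this
  omega

/-- Dynkin's term of degree `m` of the Baker-Campbell-Hausdorff series, for the commutator bracket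
of an associative `ℚ`-algebra. -/
noncomputable def commDynkinTerm (m : ℕ) (x y : A) : A :=
  ∑ k ∈ Finset.Icc 1 m, ∑ c ∈ dynkinIndex m k,
    (((-1 : ℚ) ^ (k - 1) / (k : ℚ)) * ((m : ℚ)⁻¹ * dynkinWeight c)) • commWord (dynkinWord c x y)

theorem sum_range_eq_sum_Icc {β : Type*} [AddCommMonoid β] {m N : ℕ} (hN : m ≤ N) (g : ℕ → β)
    (hg : ∀ k, m < k → g k = 0) :
    ∑ j ∈ Finset.range N, g (j + 1) = ∑ k ∈ Finset.Icc 1 m, g k := by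
  have h1 : ∑ j ∈ Finset.range N, g (j + 1) = ∑ k ∈ Finset.Icc 1 N, g k := by
    rw [Finset.range_eq_Ico, Finset.sum_Ico_add' g 0 N 1]
    rfl
  rw [h1]
  refine (Finset.sum_subset (Finset.Icc_subset_Icc_right hN) fun k hk hk' => hg k ?_).symm
  simp only [Finset.mem_Icc] at hk hk'
  omega

open IsNilpotentFiltration in
/-- Dynkin's form of the Baker-Campbell-Hausdorff formula for jointly nilpotent elements of an
associative `ℚ`-algebra. The coefficients of `log (e^{tx} e^{ty})`, a polynomial in `t`, are read
off from its Euler derivative. -/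
theorem nilLog_exp_mul_exp {J : ℕ → Submodule ℚ A} {n : ℕ} (hJ : IsNilpotentFiltration J n)
    {x y : A} (hx : x ∈ J 1) (hy : y ∈ J 1) :
    nilLog (IsNilpotent.exp x * IsNilpotent.exp y - 1) =
      ∑ m ∈ Finset.Icc 1 n, commDynkinTerm m x y := by
  have hJ' := isNilpotentFiltration_poly hJ
  have hX := C_mul_X_mem hx
  have hY := C_mul_X_mem hy
  have hXn := hJ'.isNilpotent hX
  have hYn := hJ'.isNilpotent hY
  have hu := hJ'.isNilpotent (hJ'.mul_sub_one_mem (hJ'.exp_sub_one_mem hX)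
    (hJ'.exp_sub_one_mem hY))
  set Z := nilLog (IsNilpotent.exp (C x * X) * IsNilpotent.exp (C y * X) - 1) with hZ
  have hmap : ∀ φ : A[X] →+* A, φ Z =
      nilLog (IsNilpotent.exp (φ (C x * X)) * IsNilpotent.exp (φ (C y * X)) - 1) := fun φ => by
    rw [hZ, map_nilLog φ hu, map_sub, map_mul, map_one, IsNilpotent.map_exp hXn,
      IsNilpotent.map_exp hYn]
  have hcoeff : ∀ m, 1 ≤ m → Z.coeff m = commDynkinTerm m x y := by
    intro m hm
    obtain ⟨N₀, hN₀⟩ := leibniz_nilLog_exp_mul_exp eulerPoly eulerPoly_mul hXn hYn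
      (eulerPoly_C_mul_X x) (eulerPoly_C_mul_X y) hu
    -- A box of side `B` that holds all exponents of nonzero powers and all pairs of degree `m`.
    obtain ⟨B₁, hB₁⟩ := isNilpotent_adRight hXn
    obtain ⟨B₂, hB₂⟩ := isNilpotent_adRight hYn
    obtain ⟨B, hB⟩ : ∃ B, B₁ ≤ B ∧ B₂ ≤ B ∧ m < B ∧ 2 ≤ B :=
      ⟨B₁ + B₂ + m + 2, by omega, by omega, by omega, by omega⟩
    have hD := hN₀ (N₀ + m) (by omega)
    simp only [pow_apply_eq_sum_commWord hB.2.2.2 (pow_eq_zero_of_le hB.1 hB₁)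
      (pow_eq_zero_of_le hB.2.1 hB₂)] at hD
    have hD' := congrArg (fun p : A[X] => (m : ℚ)⁻¹ • p.coeff m) hD
    have hm0 : (m : ℚ) ≠ 0 := by positivity
    simp only [coeff_eulerPoly, smul_smul, inv_mul_cancel₀ hm0, one_smul, finsetSum_coeff,
      coeff_smul, coeff_commWord_dynkinWord, smul_ite, smul_zero] at hD'
    rw [hZ, hD', commDynkinTerm, ← sum_range_eq_sum_Icc (N := N₀ + m) (by omega) _
      (fun k hk => by rw [dynkinIndex_eq_empty hk, Finset.sum_empty]), Finset.smul_sum]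
    refine Finset.sum_congr rfl fun j _ => ?_
    rw [dynkinIndex_eq_filter hB.2.2.1, Finset.sum_filter, Finset.smul_sum, Finset.smul_sum]
    refine Finset.sum_congr rfl fun c _ => ?_
    split_ifs
    · rw [smul_smul, smul_smul, Nat.add_sub_cancel]
      push_cast
      congr 1
      ring
    · simp
  have hzero : ∀ m, n < m → Z.coeff m = 0 := by
    intro m hm
    rw [hcoeff m (by omega), commDynkinTerm]
    refine Finset.sum_eq_zero fun k _ => Finset.sum_eq_zero fun c hc => ?_
    have hlen : (dynkinWord c x y).length = m := by
      rw [length_dynkinWord]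
      exact (Finset.mem_filter.mp hc).2.2
    have hmem : commWord (dynkinWord c x y) ∈ J m := by
      rw [← hlen]
      refine hJ.commWord_mem _ fun a ha => ?_
      simp only [dynkinWord, List.mem_flatten, List.mem_ofFn] at ha
      obtain ⟨_, ⟨i, rfl⟩, ha⟩ := ha
      rcases List.mem_append.mp ha with ha | ha
      · rw [List.eq_of_mem_replicate ha]; exact hx
      · rw [List.eq_of_mem_replicate ha]; exact hy
    rw [hJ.eq_zero hm hmem, smul_zero]
  have h0 : Z.coeff 0 = 0 := by
    have := hmap evalZero
    simp only [evalZero_apply, eval_mul_X, mul_zero, IsNilpotent.exp_zero, mul_one, sub_self] at this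
    rw [coeff_zero_eq_eval_zero, this, nilLog_eq_sum (pow_one 0)]
    simp
  -- The polynomial `Z` has degree at most `n`; its value at `t = 1` is the left-hand side.
  have h1 := hmap evalOne
  simp only [evalOne_apply, eval_mul_X, eval_C, mul_one] at h1
  rw [← h1, eval_eq_sum_range' (n := n + 1)
    (Nat.lt_succ_of_le (natDegree_le_iff_coeff_eq_zero.mpr hzero)), Finset.sum_range_succ', h0]
  simp only [one_pow, mul_one, add_zero]
  rw [sum_range_eq_sum_Icc le_rfl _ hzero]
  exact Finset.sum_congr rfl fun m hm => hcoeff m (Finset.mem_Icc.mp hm).1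

theorem IsNilpotentFiltration.nilLog_mem {J : ℕ → Submodule ℚ A} {n : ℕ}
    (hJ : IsNilpotentFiltration J n) {u : A} (hu : u ∈ J 1) : nilLog u ∈ J 1 :=
  Submodule.sum_mem _ fun k _ =>
    Submodule.smul_mem _ _ (hJ.antitone (by omega) (hJ.pow_mem hu k))

/-- The Baker-Campbell-Hausdorff product is associative on jointly nilpotent elements of an
associative `ℚ`-algebra, because `exp` turns it into the multiplication of the algebra. -/
theorem sum_commDynkinTerm_assoc {J : ℕ → Submodule ℚ A} {n : ℕ}
    (hJ : IsNilpotentFiltration J n) {x y z : A} (hx : x ∈ J 1) (hy : y ∈ J 1) (hz : z ∈ J 1) :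
    ∑ m ∈ Finset.Icc 1 n, commDynkinTerm m (∑ m ∈ Finset.Icc 1 n, commDynkinTerm m x y) z =
      ∑ m ∈ Finset.Icc 1 n, commDynkinTerm m x (∑ m ∈ Finset.Icc 1 n, commDynkinTerm m y z) := by
  have hmem : ∀ {a b : A}, a ∈ J 1 → b ∈ J 1 →
      IsNilpotent.exp a * IsNilpotent.exp b - 1 ∈ J 1 := fun ha hb =>
    hJ.mul_sub_one_mem (hJ.exp_sub_one_mem ha) (hJ.exp_sub_one_mem hb)
  rw [← nilLog_exp_mul_exp hJ hx hy, ← nilLog_exp_mul_exp hJ hy hz,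
    ← nilLog_exp_mul_exp hJ (hJ.nilLog_mem (hmem hx hy)) hz,
    ← nilLog_exp_mul_exp hJ hx (hJ.nilLog_mem (hmem hy hz)),
    exp_nilLog (hJ.isNilpotent (hmem hx hy)), exp_nilLog (hJ.isNilpotent (hmem hy hz)),
    add_sub_cancel, add_sub_cancel, mul_assoc]

end Filtration

end PansuDiff

/-! ### Words of Dynkin's formula -/

namespace PansuDiff

theorem mem_dynkinWord {α : Type*} {k : ℕ} {c : Fin k → ℕ × ℕ} {x y a : α} (h : a ∈ dynkinWord c x y) :
    a = x ∨ a = y := by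
  simp only [dynkinWord, List.mem_flatten, List.mem_ofFn] at h
  obtain ⟨_, ⟨i, rfl⟩, h⟩ := h
  rcases List.mem_append.mp h with h | h
  · exact Or.inl (List.eq_of_mem_replicate h)
  · exact Or.inr (List.eq_of_mem_replicate h)

theorem dynkinIndex_one_one :
    dynkinIndex 1 1 = {(fun _ => (1, 0)), (fun _ => (0, 1))} := by
  decide

/-! ### Dynkin's terms in a Banach Lie algebra -/

namespace BanachLieAlgebra

variable {M : Type*} [NormedAddCommGroup M] [NormedSpace ℝ M] (𝔤 : BanachLieAlgebra M)

theorem bracket_self (x : M) : 𝔤.bracket x x = 0 := by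
  have h : (2 : ℝ) • 𝔤.bracket x x = 0 := by
    rw [two_smul]
    nth_rewrite 2 [𝔤.skew x x]
    exact add_neg_cancel _
  exact (smul_eq_zero.mp h).resolve_left two_ne_zero

theorem leftNormed_append {l : List M} (hl : l ≠ []) (l' : List M) :
    𝔤.leftNormed (l ++ l') = l'.foldl (fun u v => 𝔤.bracket u v) (𝔤.leftNormed l) := by
  cases l with
  | nil => exact absurd rfl hl
  | cons a l => simp [leftNormed, List.foldl_append]

theorem dynkinTerm_eq (m : ℕ) (x y : M) : 𝔤.dynkinTerm m x y =
    ∑ k ∈ Finset.Icc 1 m, ∑ c ∈ dynkinIndex m k,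
      (((-1 : ℝ) ^ (k - 1) / (k : ℝ)) *
        ((m : ℝ)⁻¹ / ∏ i, (((c i).1.factorial : ℝ) * ((c i).2.factorial : ℝ)))) •
      𝔤.leftNormed (dynkinWord c x y) := rfl

/-- A linear map that preserves the bracket preserves left-normed brackets. -/
theorem map_leftNormed {N : Type*} [NormedAddCommGroup N] [NormedSpace ℝ N]
    (𝔥 : BanachLieAlgebra N) (φ : M →ₗ[ℝ] N)
    (hφ : ∀ x y, φ (𝔤.bracket x y) = 𝔥.bracket (φ x) (φ y)) (l : List M) :
    φ (𝔤.leftNormed l) = 𝔥.leftNormed (l.map φ) := by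
  induction l using List.reverseRecOn with
  | nil => simp [leftNormed]
  | append_singleton l a ih =>
    rcases eq_or_ne l [] with rfl | hl
    · simp [leftNormed]
    · rw [List.map_append, leftNormed_append _ hl, leftNormed_append _ (by simpa using hl), ← ih]
      simp [hφ]

theorem map_dynkinTerm {N : Type*} [NormedAddCommGroup N] [NormedSpace ℝ N]
    (𝔥 : BanachLieAlgebra N) (φ : M →ₗ[ℝ] N)
    (hφ : ∀ x y, φ (𝔤.bracket x y) = 𝔥.bracket (φ x) (φ y)) (m : ℕ) (x y : M) :
    φ (𝔤.dynkinTerm m x y) = 𝔥.dynkinTerm m (φ x) (φ y) := by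
  simp only [dynkinTerm_eq, map_sum, map_smul, map_leftNormed 𝔤 𝔥 φ hφ, dynkinWord_map]

theorem leftNormed_eq_zero_of_smul (x : M) (l : List M) (hl : ∀ a ∈ l, ∃ r : ℝ, a = r • x)
    (hlen : 2 ≤ l.length) : 𝔤.leftNormed l = 0 := by
  match l, hlen with
  | a :: b :: l, _ =>
    obtain ⟨r, rfl⟩ := hl a (by simp)
    obtain ⟨s, rfl⟩ := hl b (by simp)
    have h0 : ∀ l : List M, l.foldl (fun u v => 𝔤.bracket u v) 0 = 0 := by
      intro l
      induction l with
      | nil => rfl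
      | cons a l ih => simpa using ih
    simp [leftNormed, bracket_self, h0]

/-- Dynkin's terms of degree at least two vanish on a line. -/
theorem dynkinTerm_smul_smul {m : ℕ} (hm : 2 ≤ m) (x : M) (r s : ℝ) :
    𝔤.dynkinTerm m (r • x) (s • x) = 0 := by
  rw [dynkinTerm_eq]
  refine Finset.sum_eq_zero fun k _ => Finset.sum_eq_zero fun c hc => ?_
  rw [leftNormed_eq_zero_of_smul 𝔤 x, smul_zero]
  · intro a ha
    rcases mem_dynkinWord ha with rfl | rfl
    exacts [⟨r, rfl⟩, ⟨s, rfl⟩]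
  · rw [length_dynkinWord, (Finset.mem_filter.mp hc).2.2]
    exact hm

theorem dynkinTerm_one (x y : M) : 𝔤.dynkinTerm 1 x y = x + y := by
  rw [dynkinTerm_eq, Finset.Icc_self, Finset.sum_singleton, dynkinIndex_one_one,
    Finset.sum_pair (fun h => by simpa using congrFun h 0)]
  simp [dynkinWord, leftNormed]

end BanachLieAlgebra

/-! ### Layers and their filtration -/

namespace BanachHomogeneousGroup

variable {M : Type*} [NormedAddCommGroup M] [NormedSpace ℝ M] (S : BanachHomogeneousGroup M)

theorem proj_mem (i : ℕ) (x : M) : S.proj i x ∈ S.layer i := by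
  simp [proj]

theorem proj_of_mem {i : ℕ} {x : M} (hx : x ∈ S.layer i) (j : ℕ) :
    S.proj j x = if j = i then x else 0 := by
  change ((LinearEquiv.ofBijective (DirectSum.coeLinearMap S.layer) S.isInternal).symm x j : M) = _
  split_ifs with h
  · subst h
    rw [S.isInternal.ofBijective_coeLinearMap_of_mem hx]
  · rw [S.isInternal.ofBijective_coeLinearMap_of_mem_ne (Ne.symm h) hx]
    rfl

theorem proj_eq_zero {i : ℕ} (hi : i ∉ Finset.Icc 1 S.ν) (x : M) : S.proj i x = 0 := by
  have h := S.proj_mem i x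
  have hb : S.layer i = ⊥ := by
    rcases Nat.eq_zero_or_pos i with rfl | h0
    · exact S.layer_zero
    · refine S.layer_of_lt i ?_
      simp at hi
      omega
  rwa [hb, Submodule.mem_bot] at h

theorem induction_layer {P : M → Prop} (hmem : ∀ i, ∀ x ∈ S.layer i, P x)
    (hadd : ∀ x y, P x → P y → P (x + y)) (x : M) : P x := by
  have hx : x ∈ ⨆ i, S.layer i := by
    rw [S.isInternal.submodule_iSup_eq_top]; trivial
  exact Submodule.iSup_induction (motive := P) S.layer hx hmem (hmem 0 0 (Submodule.zero_mem _)) hadd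

theorem sum_proj (x : M) : ∑ i ∈ Finset.Icc 1 S.ν, S.proj i x = x := by
  induction x using S.induction_layer with
  | hmem i x hx =>
    simp only [S.proj_of_mem hx]
    rw [Finset.sum_ite_eq' ]
    split_ifs with h
    · rfl
    · have := S.proj_eq_zero h x
      rw [S.proj_of_mem hx, if_pos rfl] at this
      exact this.symm
  | hadd x y hx hy => simp only [map_add, Finset.sum_add_distrib, hx, hy]

theorem ext_proj {x y : M} (h : ∀ i, S.proj i x = S.proj i y) : x = y := by
  rw [← S.sum_proj x, ← S.sum_proj y]
  exact Finset.sum_congr rfl fun i _ => h i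

/-- The linear map that multiplies the `i`-th layer by `w i`. -/
noncomputable def weighted (w : ℕ → ℝ) : M →ₗ[ℝ] M := ∑ i ∈ Finset.Icc 1 S.ν, w i • S.proj i

theorem weighted_of_mem (w : ℕ → ℝ) {i : ℕ} {x : M} (hx : x ∈ S.layer i) :
    S.weighted w x = w i • x := by
  conv_rhs => rw [← S.sum_proj x, Finset.smul_sum]
  simp only [weighted, LinearMap.sum_apply, LinearMap.smul_apply]
  refine Finset.sum_congr rfl fun j _ => ?_
  rw [S.proj_of_mem hx]
  split_ifs with h
  · rw [h]
  · simp

theorem proj_weighted (w : ℕ → ℝ) (i : ℕ) (x : M) :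
    S.proj i (S.weighted w x) = w i • S.proj i x := by
  induction x using S.induction_layer with
  | hmem j x hx =>
    rw [S.weighted_of_mem w hx, map_smul, S.proj_of_mem hx]
    split_ifs with h
    · rw [h]
    · simp
  | hadd x y hx hy => rw [map_add, map_add, hx, hy, map_add, smul_add]

theorem dil_eq_weighted (r : ℝ) (x : M) : S.dil r x = S.weighted (fun i => r ^ i) x := by
  simp [dil, weighted]

/-- The sum of the layers of index at least `j`, as the common kernel of the other projections. -/
noncomputable def filt (j : ℕ) : Submodule ℝ M := ⨅ i : Fin j, LinearMap.ker (S.proj i)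

theorem mem_filt {j : ℕ} {x : M} : x ∈ S.filt j ↔ ∀ i < j, S.proj i x = 0 := by
  simp only [filt, Submodule.mem_iInf, LinearMap.mem_ker]
  exact ⟨fun h i hi => h ⟨i, hi⟩, fun h i => h i i.2⟩

theorem filt_antitone : Antitone S.filt := fun _ _ h _ hx =>
  S.mem_filt.mpr fun k hk => S.mem_filt.mp hx k (hk.trans_le h)

theorem mem_filt_one (x : M) : x ∈ S.filt 1 :=
  S.mem_filt.mpr fun i hi => S.proj_eq_zero (by simp; omega) x

theorem eq_zero_of_mem_filt {x : M} (hx : x ∈ S.filt (S.ν + 1)) : x = 0 := by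
  rw [← S.sum_proj x]
  exact Finset.sum_eq_zero fun i hi => S.mem_filt.mp hx i
    (Nat.lt_succ_of_le (Finset.mem_Icc.mp hi).2)

theorem layer_le_filt (j : ℕ) : S.layer j ≤ S.filt j := fun x hx =>
  S.mem_filt.mpr fun i hi => by rw [S.proj_of_mem hx, if_neg (by omega)]

theorem bracket_mem_filt {i j : ℕ} {x y : M} (hx : x ∈ S.filt i) (hy : y ∈ S.filt j) :
    S.bracket x y ∈ S.filt (i + j) := by
  rw [← S.sum_proj x, map_sum, sum_apply]
  refine Submodule.sum_mem _ fun a _ => ?_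
  rw [← S.sum_proj y, map_sum]
  refine Submodule.sum_mem _ fun b _ => ?_
  by_cases ha : a < i
  · rw [S.mem_filt.mp hx a ha]; simp
  · by_cases hb : b < j
    · rw [S.mem_filt.mp hy b hb]; simp
    · exact S.filt_antitone (by omega) (S.layer_le_filt _
        (S.bracket_mem a b _ (S.proj_mem a x) _ (S.proj_mem b y)))

/-- The degree derivation, which multiplies the `i`-th layer by `i`. -/
noncomputable def degree : M →ₗ[ℝ] M := S.weighted fun i => i

theorem induction_layer₂ {P : M → M → Prop}
    (hmem : ∀ i j, ∀ x ∈ S.layer i, ∀ y ∈ S.layer j, P x y)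
    (hl : ∀ x x' y, P x y → P x' y → P (x + x') y)
    (hr : ∀ x y y', P x y → P x y' → P x (y + y')) (x y : M) : P x y := by
  induction x using S.induction_layer with
  | hmem i x hx =>
    induction y using S.induction_layer with
    | hmem j y hy => exact hmem i j x hx y hy
    | hadd y y' h h' => exact hr _ _ _ h h'
  | hadd x x' h h' => exact hl _ _ _ h h'

theorem degree_bracket (x y : M) :
    S.degree (S.bracket x y) = S.bracket (S.degree x) y + S.bracket x (S.degree y) := by
  induction x, y using S.induction_layer₂ with
  | hmem i j x hx y hy =>
    rw [degree, S.weighted_of_mem _ (S.bracket_mem i j x hx y hy), S.weighted_of_mem _ hx,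
      S.weighted_of_mem _ hy]
    simp [add_smul]
  | hl x x' y h h' => simp only [map_add, add_apply, h, h']; abel
  | hr x y y' h h' => simp only [map_add, h, h']; abel

theorem dil_bracket (r : ℝ) (x y : M) :
    S.dil r (S.bracket x y) = S.bracket (S.dil r x) (S.dil r y) := by
  simp only [dil_eq_weighted]
  induction x, y using S.induction_layer₂ with
  | hmem i j x hx y hy =>
    rw [S.weighted_of_mem _ (S.bracket_mem i j x hx y hy), S.weighted_of_mem _ hx,
      S.weighted_of_mem _ hy]
    simp [pow_add, smul_smul, mul_comm]
  | hl x x' y h h' => simp only [map_add, add_apply, h, h']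
  | hr x y y' h h' => simp only [map_add, h, h']

/-! ### The extended adjoint representation and associativity -/

/-- The adjoint representation of `M`, extended by the degree derivation: the element `x` acts on
`M × ℝ` by `(y, c) ↦ ([x, y] - c · degree x, 0)`. Unlike the adjoint representation of `M` on
itself it is always faithful. -/
noncomputable def extAd : M →ₗ[ℝ] Module.End ℝ (M × ℝ) :=
  LinearMap.mk₂ ℝ (fun x p => (S.bracket x p.1 - p.2 • S.degree x, 0))
    (fun x x' p => by ext <;> simp; abel)
    (fun r x p => Prod.ext (by simp [smul_sub, smul_comm p.2 r]) (by simp))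
    (fun x p p' => by ext <;> simp [add_smul]; abel)
    (fun r x p => by ext <;> simp [smul_sub, smul_smul])

theorem extAd_apply (x : M) (p : M × ℝ) :
    S.extAd x p = (S.bracket x p.1 - p.2 • S.degree x, 0) := rfl

theorem extAd_injective : Function.Injective S.extAd := by
  rw [← LinearMap.ker_eq_bot, LinearMap.ker_eq_bot']
  intro x hx
  have h := congrArg Prod.fst (LinearMap.congr_fun hx (0, 1))
  simp only [extAd_apply, map_zero, one_smul, zero_sub, LinearMap.zero_apply, Prod.fst_zero,
    neg_eq_zero] at h
  refine S.ext_proj fun i => ?_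
  by_cases hi : i ∈ Finset.Icc 1 S.ν
  · have h' := congrArg (S.proj i) h
    rw [degree, proj_weighted, map_zero, smul_eq_zero] at h'
    rcases h' with h' | h'
    · have : 1 ≤ i := (Finset.mem_Icc.mp hi).1
      exfalso
      have : (i : ℝ) ≠ 0 := by positivity
      contradiction
    · rw [h', map_zero]
  · rw [S.proj_eq_zero hi, S.proj_eq_zero hi]

theorem extAd_bracket (x y : M) :
    S.extAd (S.bracket x y) = S.extAd x * S.extAd y - S.extAd y * S.extAd x := by
  refine LinearMap.ext fun p => ?_
  have hj := S.jacobi x y p.1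
  rw [S.skew p.1 x, S.skew p.1 (S.bracket x y), map_neg] at hj
  simp only [LinearMap.sub_apply, Module.End.mul_apply, extAd_apply, degree_bracket, map_sub,
    map_smul, Prod.mk_sub_mk, sub_zero, zero_smul, smul_add]
  have h1 : S.bracket (S.bracket x y) p.1 = S.bracket x (S.bracket y p.1) -
      S.bracket y (S.bracket x p.1) := by
    rw [← sub_eq_zero, ← neg_eq_zero, ← hj]
    abel
  rw [h1, S.skew (S.degree x) y, smul_neg]
  congr 1
  abel

/-- The endomorphisms of a real vector space, as an algebra over the rational numbers. -/
noncomputable abbrev ratAlgebraEnd (V : Type*) [AddCommGroup V] [Module ℝ V] :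
    Algebra ℚ (Module.End ℝ V) :=
  ((algebraMap ℝ (Module.End ℝ V)).comp (algebraMap ℚ ℝ)).toAlgebra'
    fun q φ => Algebra.commutes (q : ℝ) φ

theorem ratAlgebraEnd_smul {V : Type*} [AddCommGroup V] [Module ℝ V] (q : ℚ)
    (φ : Module.End ℝ V) :
    letI := ratAlgebraEnd V
    q • φ = (q : ℝ) • φ := by
  let := ratAlgebraEnd V
  rw [Algebra.smul_def, Algebra.smul_def]
  rfl

/-- The filtration of `M × ℝ` that puts the additional coordinate in degree zero. -/
def extFilt (j : ℕ) : Submodule ℝ (M × ℝ) where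
  carrier := {p | p.1 ∈ S.filt j ∧ (1 ≤ j → p.2 = 0)}
  add_mem' hp hq := ⟨Submodule.add_mem _ hp.1 hq.1, fun h => by simp [hp.2 h, hq.2 h]⟩
  zero_mem' := ⟨Submodule.zero_mem _, fun _ => rfl⟩
  smul_mem' r p hp := ⟨Submodule.smul_mem _ r hp.1, fun h => by simp [hp.2 h]⟩

theorem extFilt_antitone : Antitone S.extFilt := fun _ _ h _ hp =>
  ⟨S.filt_antitone h hp.1, fun hi => hp.2 (hi.trans h)⟩

/-- The endomorphisms of `M × ℝ` that raise the filtration degree by at least `i`. -/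
noncomputable def endFilt (i : ℕ) :
    letI := ratAlgebraEnd (M × ℝ)
    Submodule ℚ (Module.End ℝ (M × ℝ)) :=
  letI := ratAlgebraEnd (M × ℝ)
  { carrier := {φ | ∀ j, ∀ p ∈ S.extFilt j, φ p ∈ S.extFilt (i + j)}
    add_mem' := fun hφ hψ j p hp => Submodule.add_mem _ (hφ j p hp) (hψ j p hp)
    zero_mem' := fun _ _ _ => Submodule.zero_mem _
    smul_mem' := fun q φ hφ j p hp => by
      rw [ratAlgebraEnd_smul]
      exact Submodule.smul_mem _ _ (hφ j p hp) }

theorem isNilpotentFiltration_endFilt :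
    letI := ratAlgebraEnd (M × ℝ)
    IsNilpotentFiltration S.endFilt S.ν := by
  let := ratAlgebraEnd (M × ℝ)
  refine ⟨?_, ?_, ?_⟩
  · intro i j φ ψ hφ hψ k p hp
    rw [add_assoc]
    exact hφ _ _ (hψ _ _ hp)
  · intro i φ hφ j p hp
    exact S.extFilt_antitone (by omega) (hφ j p hp)
  · refine (Submodule.eq_bot_iff _).mpr fun φ hφ => LinearMap.ext fun p => ?_
    have h0 : p ∈ S.extFilt 0 := ⟨S.mem_filt.mpr fun i hi => absurd hi (Nat.not_lt_zero i),
      fun h => absurd h (by omega)⟩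
    have h := hφ 0 p h0
    exact Prod.ext (S.eq_zero_of_mem_filt h.1) (h.2 (by omega))

theorem extAd_mem_endFilt (x : M) :
    letI := ratAlgebraEnd (M × ℝ)
    S.extAd x ∈ S.endFilt 1 := by
  let := ratAlgebraEnd (M × ℝ)
  intro j p hp
  refine ⟨?_, fun _ => rfl⟩
  have hb := S.bracket_mem_filt (S.mem_filt_one x) hp.1
  rcases Nat.eq_zero_or_pos j with rfl | hj
  · exact S.mem_filt_one _
  · rw [extAd_apply, hp.2 hj, zero_smul, sub_zero]
    exact hb

theorem extAd_leftNormed (l : List M) : S.extAd (S.leftNormed l) = commWord (l.map S.extAd) := by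
  induction l using List.reverseRecOn with
  | nil => simp [BanachLieAlgebra.leftNormed, commWord]
  | append_singleton l a ih =>
    rcases eq_or_ne l [] with rfl | hl
    · simp [BanachLieAlgebra.leftNormed, commWord]
    · rw [List.map_append, BanachLieAlgebra.leftNormed_append _ hl,
        commWord_append (by simpa using hl), ← ih]
      simp [extAd_bracket]

theorem extAd_dynkinTerm (m : ℕ) (x y : M) :
    letI := ratAlgebraEnd (M × ℝ)
    S.extAd (S.dynkinTerm m x y) = commDynkinTerm m (S.extAd x) (S.extAd y) := by
  let := ratAlgebraEnd (M × ℝ)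
  rw [BanachLieAlgebra.dynkinTerm_eq, commDynkinTerm, map_sum]
  refine Finset.sum_congr rfl fun k _ => ?_
  rw [map_sum]
  refine Finset.sum_congr rfl fun c _ => ?_
  rw [map_smul, extAd_leftNormed, dynkinWord_map, ratAlgebraEnd_smul]
  congr 1
  simp [dynkinWeight, div_eq_mul_inv, Finset.prod_mul_distrib, mul_comm]

/-- Dynkin's term of degree one is `x + y`. -/
theorem mul_eq_sum (x y : M) : S.mul x y = ∑ m ∈ Finset.Icc 1 S.ν, S.dynkinTerm m x y := by
  rcases Nat.eq_zero_or_pos S.ν with h | h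
  · have h0 : ∀ z : M, z = 0 := fun z => by rw [← S.sum_proj z, h]; rfl
    rw [h0 (S.mul x y), h0 (∑ m ∈ _, _)]
  · rw [mul, ← Finset.insert_Icc_add_one_left_eq_Icc (show 1 ≤ S.ν from h),
      Finset.sum_insert (by simp), BanachLieAlgebra.dynkinTerm_one]
    rfl

/-- The group operation is associative: the faithful representation `extAd` reduces this to the
case of an associative algebra. -/
theorem mul_assoc (x y z : M) : S.mul (S.mul x y) z = S.mul x (S.mul y z) := by
  let := ratAlgebraEnd (M × ℝ)
  apply S.extAd_injective
  have h : ∀ a b : M, S.extAd (S.mul a b) =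
      ∑ m ∈ Finset.Icc 1 S.ν, commDynkinTerm m (S.extAd a) (S.extAd b) := fun a b => by
    rw [mul_eq_sum, map_sum]
    exact Finset.sum_congr rfl fun m _ => S.extAd_dynkinTerm m a b
  rw [h, h, h, h]
  exact sum_commDynkinTerm_assoc S.isNilpotentFiltration_endFilt (S.extAd_mem_endFilt x)
    (S.extAd_mem_endFilt y) (S.extAd_mem_endFilt z)

/-! ### Inverses and dilations -/

/-- On a line all brackets vanish, so the group operation is the addition. -/
theorem mul_smul_smul (x : M) (r s : ℝ) : S.mul (r • x) (s • x) = (r + s) • x := by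
  rw [mul, Finset.sum_eq_zero, add_zero, add_smul]
  exact fun m hm => S.dynkinTerm_smul_smul (Finset.mem_Icc.mp hm).1 x r s

theorem mul_zero (x : M) : S.mul x 0 = x := by simpa using S.mul_smul_smul x 1 0

theorem zero_mul (x : M) : S.mul 0 x = x := by simpa using S.mul_smul_smul x 0 1

theorem mul_inv_self (x : M) : S.mul x (S.inv x) = 0 := by
  simpa [inv] using S.mul_smul_smul x 1 (-1)

theorem inv_mul_self (x : M) : S.mul (S.inv x) x = 0 := by
  simpa [inv] using S.mul_smul_smul x (-1) 1

theorem inv_mul_cancel_left (x y : M) : S.mul (S.inv x) (S.mul x y) = y := by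
  rw [← mul_assoc, inv_mul_self, zero_mul]

theorem mul_inv_cancel_left (x y : M) : S.mul x (S.mul (S.inv x) y) = y := by
  rw [← mul_assoc, mul_inv_self, zero_mul]

theorem inv_inv (x : M) : S.inv (S.inv x) = x := neg_neg x

theorem inv_mul (x y : M) : S.inv (S.mul x y) = S.mul (S.inv y) (S.inv x) := by
  have h : S.mul (S.mul x y) (S.mul (S.inv y) (S.inv x)) = 0 := by
    rw [mul_assoc, mul_inv_cancel_left, mul_inv_self]
  rw [← S.inv_mul_cancel_left (S.mul x y) (S.mul (S.inv y) (S.inv x)), h, mul_zero]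

theorem inv_mul_mul (z x y : M) :
    S.mul (S.inv (S.mul z x)) (S.mul z y) = S.mul (S.inv x) y := by
  rw [inv_mul, mul_assoc, inv_mul_cancel_left]

theorem map_mul (φ : M →ₗ[ℝ] M) (hφ : ∀ x y, φ (S.bracket x y) = S.bracket (φ x) (φ y))
    (x y : M) : φ (S.mul x y) = S.mul (φ x) (φ y) := by
  simp only [mul, map_add, map_sum,
    BanachLieAlgebra.map_dynkinTerm S.toBanachLieAlgebra S.toBanachLieAlgebra φ hφ]

theorem dil_mul (r : ℝ) (x y : M) : S.dil r (S.mul x y) = S.mul (S.dil r x) (S.dil r y) := by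
  have h := S.map_mul (S.weighted fun i => r ^ i)
    (fun x y => by simpa only [dil_eq_weighted] using S.dil_bracket r x y) x y
  simpa only [dil_eq_weighted] using h

theorem proj_dil (r : ℝ) (i : ℕ) (x : M) : S.proj i (S.dil r x) = r ^ i • S.proj i x := by
  rw [dil_eq_weighted, proj_weighted]

theorem dil_inv (r : ℝ) (x : M) : S.dil r (S.inv x) = S.inv (S.dil r x) := by
  simp only [dil_eq_weighted, inv, map_neg]

theorem dil_zero_right (r : ℝ) : S.dil r 0 = 0 := by simp only [dil_eq_weighted, map_zero]

theorem dil_dil (r s : ℝ) (x : M) : S.dil r (S.dil s x) = S.dil (r * s) x :=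
  S.ext_proj fun i => by simp only [proj_dil, smul_smul, mul_pow]

theorem dil_one (x : M) : S.dil 1 x = x := S.ext_proj fun i => by simp [proj_dil]

theorem dil_dil_div {r : ℝ} (hr : r ≠ 0) (x : M) : S.dil r (S.dil (1 / r) x) = x := by
  rw [dil_dil, mul_one_div_cancel hr, dil_one]

/-! ### The homogeneous norm and distance -/

section HomNorm

variable (σ : ℕ → ℝ≥0)

theorem homNorm_nonneg (x : M) : 0 ≤ S.homNorm σ x := NNReal.coe_nonneg _

theorem homNorm_inv (x : M) : S.homNorm σ (S.inv x) = S.homNorm σ x := by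
  simp [homNorm, inv]

theorem homNorm_dil {r : ℝ} (hr : 0 ≤ r) (x : M) :
    S.homNorm σ (S.dil r x) = r * S.homNorm σ x := by
  lift r to ℝ≥0 using hr
  rw [homNorm, homNorm, ← NNReal.coe_mul, NNReal.mul_finset_sup]
  congr 1
  refine Finset.sup_congr rfl fun i hi => ?_
  have hi' : (i : ℝ) ≠ 0 := Nat.cast_ne_zero.mpr (by have := Finset.mem_Icc.mp hi; omega)
  rw [proj_dil, nnnorm_smul, NNReal.mul_rpow, nnnorm_pow, ← NNReal.rpow_natCast, ← NNReal.rpow_mul,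
    mul_one_div_cancel hi', NNReal.rpow_one, NNReal.nnnorm_eq]
  ring

theorem homNorm_zero : S.homNorm σ 0 = 0 := by
  simpa [dil_zero_right] using S.homNorm_dil σ le_rfl (0 : M)

variable {σ}

theorem eq_zero_of_homNorm_eq_zero (hσ : ∀ i, 1 ≤ i → i ≤ S.ν → 0 < σ i) {x : M}
    (hx : S.homNorm σ x = 0) : x = 0 := by
  rw [homNorm, NNReal.coe_eq_zero, ← bot_eq_zero', Finset.sup_eq_bot_iff] at hx
  rw [← S.sum_proj x]
  refine Finset.sum_eq_zero fun i hi => ?_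
  have h := hx i hi
  rw [Finset.mem_Icc] at hi
  rw [bot_eq_zero', mul_eq_zero] at h
  rcases h with h | h
  · exact absurd h (hσ i hi.1 hi.2).ne'
  · rw [NNReal.rpow_eq_zero_iff] at h
    exact nnnorm_eq_zero.mp h.1

theorem homDist_nonneg (x y : M) : 0 ≤ S.homDist σ x y := S.homNorm_nonneg σ _

theorem homDist_comm (x y : M) : S.homDist σ x y = S.homDist σ y x := by
  rw [homDist, homDist, ← homNorm_inv, inv_mul, inv_inv]

theorem homDist_mul_left (z x y : M) : S.homDist σ (S.mul z x) (S.mul z y) = S.homDist σ x y := by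
  rw [homDist, homDist, inv_mul_mul]

theorem homDist_dil {r : ℝ} (hr : 0 ≤ r) (x y : M) :
    S.homDist σ (S.dil r x) (S.dil r y) = r * S.homDist σ x y := by
  rw [homDist, homDist, ← dil_inv, ← dil_mul, homNorm_dil _ _ hr]

theorem homDist_triangle (hσ : S.IsHomNorm σ) (x y z : M) :
    S.homDist σ x z ≤ S.homDist σ x y + S.homDist σ y z := by
  have h := hσ.mul_le (S.mul (S.inv x) y) (S.mul (S.inv y) z)
  rwa [mul_assoc, mul_inv_cancel_left] at h

theorem eq_of_homDist_eq_zero (hσ : S.IsHomNorm σ) {x y : M} (h : S.homDist σ x y = 0) :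
    x = y := by
  have h' := S.eq_zero_of_homNorm_eq_zero hσ.pos h
  rw [← S.mul_inv_cancel_left x y, h', mul_zero]

end HomNorm

end BanachHomogeneousGroup

end PansuDiff

/-! ### Gauges on a finite dimensional graded group -/

namespace PansuDiff

namespace BanachLieAlgebra

variable {M : Type*} [NormedAddCommGroup M] [NormedSpace ℝ M] (𝔤 : BanachLieAlgebra M)

theorem continuous_leftNormed {X : Type*} [TopologicalSpace X] (l : List (X → M))
    (hl : ∀ g ∈ l, Continuous g) : Continuous fun t => 𝔤.leftNormed (l.map fun g => g t) := by
  induction l using List.reverseRecOn with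
  | nil => exact continuous_const
  | append_singleton l a ih =>
    have ha : Continuous a := hl a (by simp)
    rcases eq_or_ne l [] with rfl | hne
    · exact ha
    · have h := ih fun g hg => hl g (by simp [hg])
      have heq : ∀ t, 𝔤.leftNormed ((l ++ [a]).map fun g => g t) =
          𝔤.bracket (𝔤.leftNormed (l.map fun g => g t)) (a t) := fun t => by
        rw [List.map_append, leftNormed_append _ (by simpa using hne)]
        rfl
      simp only [heq]
      exact (𝔤.bracket.continuous.comp h).clm_apply ha

theorem continuous_dynkinTerm (m : ℕ) : Continuous fun p : M × M => 𝔤.dynkinTerm m p.1 p.2 := by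
  simp only [dynkinTerm_eq]
  refine continuous_finsetSum _ fun k _ => continuous_finsetSum _ fun c _ => ?_
  refine Continuous.const_smul ?_ _
  have h : ∀ p : M × M, dynkinWord c p.1 p.2 =
      (dynkinWord c (Prod.fst : M × M → M) Prod.snd).map fun g => g p := fun p => by
    rw [dynkinWord_map]
  simp only [h]
  refine 𝔤.continuous_leftNormed _ fun g hg => ?_
  rcases mem_dynkinWord hg with rfl | rfl
  exacts [continuous_fst, continuous_snd]

end BanachLieAlgebra

namespace BanachHomogeneousGroup

variable {G : Type*} [NormedAddCommGroup G] [NormedSpace ℝ G] (S : BanachHomogeneousGroup G)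

theorem continuous_mul : Continuous fun p : G × G => S.mul p.1 p.2 :=
  (continuous_fst.add continuous_snd).add
    (continuous_finsetSum _ fun m _ => S.continuous_dynkinTerm m)

/-- Modulo higher layers the group operation is the addition. -/
theorem mul_sub_add_mem_filt {j : ℕ} (hj : 1 ≤ j) {x y : G} (hx : x ∈ S.filt j)
    (hy : y ∈ S.filt j) : S.mul x y - (x + y) ∈ S.filt (j + 1) := by
  have hfold : ∀ (l : List G) (u : G), u ∈ S.filt (j + 1) → (∀ a ∈ l, a ∈ S.filt j) →
      l.foldl (fun u v => S.bracket u v) u ∈ S.filt (j + 1) := by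
    intro l
    induction l with
    | nil => exact fun u hu _ => hu
    | cons a l ih =>
      intro u hu h
      refine ih _ ?_ fun b hb => h b (by simp [hb])
      exact S.filt_antitone (by omega) (S.bracket_mem_filt hu (h a (by simp)))
  have hln : ∀ l : List G, 2 ≤ l.length → (∀ a ∈ l, a ∈ S.filt j) →
      S.leftNormed l ∈ S.filt (j + 1) := by
    intro l hlen h
    match l, hlen with
    | a :: b :: l, _ =>
      refine hfold l _ ?_ fun c hc => h c (by simp [hc])
      exact S.filt_antitone (by omega) (S.bracket_mem_filt (h a (by simp)) (h b (by simp)))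
  rw [mul, add_sub_cancel_left]
  refine Submodule.sum_mem _ fun m hm => ?_
  rw [BanachLieAlgebra.dynkinTerm_eq]
  refine Submodule.sum_mem _ fun k _ => Submodule.sum_mem _ fun c hc => Submodule.smul_mem _ _ ?_
  refine hln _ ?_ fun a ha => ?_
  · rw [length_dynkinWord, (Finset.mem_filter.mp hc).2.2]
    exact (Finset.mem_Icc.mp hm).1
  · rcases mem_dynkinWord ha with rfl | rfl
    exacts [hx, hy]

theorem sub_proj_mem_filt {j : ℕ} {x : G} (hx : x ∈ S.filt j) :
    x - S.proj j x ∈ S.filt (j + 1) := by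
  refine S.mem_filt.mpr fun i hi => ?_
  rw [map_sub, S.proj_of_mem (S.proj_mem j x)]
  split_ifs with h
  · rw [h, sub_self]
  · rw [S.mem_filt.mp hx i (by omega), sub_zero]

theorem norm_le_sum_homNorm_pow (z : G) :
    ‖z‖ ≤ ∑ i ∈ Finset.Icc 1 S.ν, S.homNorm (fun _ => 1) z ^ i := by
  conv_lhs => rw [← S.sum_proj z]
  refine (norm_sum_le _ _).trans (Finset.sum_le_sum fun i hi => ?_)
  have h : ‖S.proj i z‖₊ ^ (1 / (i : ℝ)) ≤
      (Finset.Icc 1 S.ν).sup fun i => 1 * ‖S.proj i z‖₊ ^ (1 / (i : ℝ)) := by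
    have := Finset.le_sup (f := fun i => (1 : ℝ≥0) * ‖S.proj i z‖₊ ^ (1 / (i : ℝ))) hi
    simpa using this
  have hi' : i ≠ 0 := by have := Finset.mem_Icc.mp hi; omega
  have h2 := pow_le_pow_left₀ zero_le h i
  rw [one_div, NNReal.rpow_inv_natCast_pow _ hi'] at h2
  rw [homNorm]
  exact_mod_cast h2

/-- A homogeneous gauge: a nonnegative function on the group that is subadditive, symmetric and
homogeneous with respect to dilations. -/
structure IsGauge (p : G → ℝ) : Prop where
  nonneg : ∀ x, 0 ≤ p x
  mul_le : ∀ x y, p (S.mul x y) ≤ p x + p y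
  map_inv : ∀ x, p (S.inv x) = p x
  map_dil : ∀ r, 0 < r → ∀ x, p (S.dil r x) = r * p x

namespace IsGauge

variable {S} {p : G → ℝ}

theorem map_zero (hp : S.IsGauge p) : p 0 = 0 := by
  have h := hp.map_dil 2 two_pos 0
  rw [dil_zero_right] at h
  linarith

theorem map_smul_of_pos (hp : S.IsGauge p) {j : ℕ} (hj : j ≠ 0) {g : G} (hg : g ∈ S.layer j)
    {a : ℝ} (ha : 0 < a) : p (a • g) = a ^ (j : ℝ)⁻¹ * p g := by
  rw [← hp.map_dil _ (Real.rpow_pos_of_pos ha _), dil_eq_weighted, S.weighted_of_mem _ hg,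
    Real.rpow_inv_natCast_pow ha.le hj]

theorem map_smul_le (hp : S.IsGauge p) {j : ℕ} (hj : j ≠ 0) {g : G} (hg : g ∈ S.layer j)
    (a : ℝ) : p (a • g) ≤ |a| ^ (j : ℝ)⁻¹ * p g := by
  rcases lt_trichotomy a 0 with ha | rfl | ha
  · have h : a • g = S.inv (|a| • g) := by rw [abs_of_neg ha, inv, neg_smul, neg_neg]
    rw [h, hp.map_inv, hp.map_smul_of_pos hj hg (abs_pos.mpr ha.ne)]
  · rw [zero_smul, hp.map_zero]
    exact mul_nonneg (Real.rpow_nonneg (abs_nonneg _) _) (hp.nonneg g)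
  · rw [abs_of_pos ha, hp.map_smul_of_pos hj hg ha]

end IsGauge

/-- A continuous self-map along which `p` is bounded on compact sets. -/
def IsTame (p : G → ℝ) (w : G → G) : Prop :=
  Continuous w ∧ ∀ K, IsCompact K → ∃ C, ∀ z ∈ K, p (w z) ≤ C

variable {S} {p : G → ℝ}

theorem IsTame.mul (hp : S.IsGauge p) {w v : G → G} (hw : IsTame p w) (hv : IsTame p v) :
    IsTame p fun z => S.mul (w z) (v z) := by
  refine ⟨S.continuous_mul.comp (hw.1.prodMk hv.1), fun K hK => ?_⟩
  obtain ⟨C, hC⟩ := hw.2 K hK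
  obtain ⟨C', hC'⟩ := hv.2 K hK
  exact ⟨C + C', fun z hz => (hp.mul_le _ _).trans (add_le_add (hC z hz) (hC' z hz))⟩

theorem IsGauge.isTame_smul (hp : S.IsGauge p) {j : ℕ} (hj : j ≠ 0) {g : G}
    (hg : g ∈ S.layer j) {φ : G → ℝ} (hφ : Continuous φ) : IsTame p fun z => φ z • g := by
  refine ⟨hφ.smul continuous_const, fun K hK => ?_⟩
  obtain ⟨R, hR⟩ := hK.exists_bound_of_continuousOn hφ.continuousOn
  refine ⟨R ^ (j : ℝ)⁻¹ * p g, fun z hz => (hp.map_smul_le hj hg _).trans ?_⟩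
  gcongr
  · exact hp.nonneg g
  · exact hR z hz

variable [FiniteDimensional ℝ G]

/-- Every element is a product of factors on coordinate lines inside the layers, chosen
continuously, up to an error in the layers of index at least `j`. On a line inside a layer the
gauge is determined by homogeneity. -/
theorem IsGauge.exists_isTame (hp : S.IsGauge p) (j : ℕ) :
    ∃ w, IsTame p w ∧ ∀ z, S.mul (S.inv (w z)) z ∈ S.filt (j + 1) := by
  induction j with
  | zero =>
    exact ⟨fun _ => 0, ⟨continuous_const, fun K _ => ⟨p 0, fun _ _ => le_rfl⟩⟩,
      fun z => S.mem_filt_one _⟩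
  | succ j ih =>
    obtain ⟨w, hw, hwz⟩ := ih
    set y : G → G := fun z => S.mul (S.inv (w z)) z with hy
    have hyc : Continuous y := S.continuous_mul.comp (hw.1.neg.prodMk continuous_id)
    let b := Module.finBasis ℝ (S.layer (j + 1))
    let P : G →ₗ[ℝ] S.layer (j + 1) := (S.proj (j + 1)).codRestrict _ (S.proj_mem (j + 1))
    have hac : ∀ k, Continuous fun z => b.coord k (P (y z)) := fun k =>
      ((b.coord k ∘ₗ P).continuous_of_finiteDimensional).comp hyc
    -- A product of factors `aₖ bₖ` in the layer `j + 1` agrees with their sum up to higher layers.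
    have hs : ∀ s : Finset (Fin (Module.finrank ℝ (S.layer (j + 1)))),
        ∃ v, IsTame p v ∧ (∀ z, v z ∈ S.filt (j + 1)) ∧
          ∀ z, v z - ∑ k ∈ s, b.coord k (P (y z)) • (b k : G) ∈ S.filt (j + 1 + 1) := by
      intro s
      induction s using Finset.induction_on with
      | empty =>
        refine ⟨fun _ => 0, ⟨continuous_const, fun K _ => ⟨p 0, fun _ _ => le_rfl⟩⟩,
          fun z => Submodule.zero_mem _, fun z => ?_⟩
        simp
      | insert k s hk ih =>
        obtain ⟨v, hv, hv1, hv2⟩ := ih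
        have hmem : ∀ z, b.coord k (P (y z)) • (b k : G) ∈ S.filt (j + 1) := fun z =>
          Submodule.smul_mem _ _ (S.layer_le_filt _ (b k).2)
        have hprod := fun z => S.mul_sub_add_mem_filt (Nat.le_add_left 1 j) (hv1 z) (hmem z)
        refine ⟨_, hv.mul hp (hp.isTame_smul (Nat.succ_ne_zero j) (b k).2 (hac k)),
          fun z => ?_, fun z => ?_⟩
        · have := Submodule.add_mem _ (S.filt_antitone (Nat.le_succ _) (hprod z))
            (Submodule.add_mem _ (hv1 z) (hmem z))
          rwa [sub_add_cancel] at this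
        · have := Submodule.add_mem _ (hprod z) (hv2 z)
          rw [Finset.sum_insert hk]
          convert this using 1
          abel
    obtain ⟨v, hv, hv1, hv2⟩ := hs Finset.univ
    refine ⟨_, hw.mul hp hv, fun z => ?_⟩
    have hsum : ∑ k, b.coord k (P (y z)) • (b k : G) = S.proj (j + 1) (y z) := by
      have := congrArg (S.layer (j + 1)).subtype (b.sum_repr (P (y z)))
      rw [map_sum] at this
      exact this
    rw [inv_mul, mul_assoc]
    change S.mul (S.inv (v z)) (y z) ∈ _
    have h1 := S.mul_sub_add_mem_filt (Nat.le_add_left 1 j) (Submodule.neg_mem _ (hv1 z)) (hwz z)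
    have h2 := hv2 z
    rw [hsum] at h2
    have h3 := S.sub_proj_mem_filt (hwz z)
    have h4 := Submodule.add_mem _ h1 (Submodule.sub_mem _ h3 h2)
    convert h4 using 1
    simp only [inv, hy]
    abel

theorem IsGauge.bounded_on_compact (hp : S.IsGauge p) {K : Set G} (hK : IsCompact K) :
    ∃ C, ∀ z ∈ K, p z ≤ C := by
  obtain ⟨w, hw, hwz⟩ := hp.exists_isTame S.ν
  obtain ⟨C, hC⟩ := hw.2 K hK
  refine ⟨C, fun z hz => ?_⟩
  have h := S.eq_zero_of_mem_filt (hwz z)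
  have hz' := S.mul_inv_cancel_left (w z) z
  rw [h, mul_zero] at hz'
  have hw' := hC z hz
  rwa [hz'] at hw'

variable (S)

theorem continuous_homNorm (σ : ℕ → ℝ≥0) : Continuous (S.homNorm σ) := by
  refine NNReal.continuous_coe.comp (Continuous.finset_sup_apply fun i _ => ?_)
  refine continuous_const.mul ((NNReal.continuous_rpow_const (by positivity)).comp ?_)
  exact (S.proj i).continuous_of_finiteDimensional.nnnorm

theorem isCompact_homNorm_le (R : ℝ) : IsCompact {z | S.homNorm (fun _ => 1) z ≤ R} := by
  refine (isCompact_closedBall (0 : G) (∑ i ∈ Finset.Icc 1 S.ν, R ^ i)).of_isClosed_subset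
    (isClosed_le (S.continuous_homNorm _) continuous_const) fun z hz => ?_
  rw [mem_closedBall_zero_iff]
  exact (S.norm_le_sum_homNorm_pow z).trans (Finset.sum_le_sum fun i _ =>
    pow_le_pow_left₀ (S.homNorm_nonneg _ z) hz i)

variable {S}

/-- A gauge is bounded by a multiple of the homogeneous norm: it is bounded on the unit ball, and
both sides are homogeneous. -/
theorem IsGauge.le_homNorm (hp : S.IsGauge p) :
    ∃ C, 0 ≤ C ∧ ∀ z, p z ≤ C * S.homNorm (fun _ => 1) z := by
  obtain ⟨C, hC⟩ := hp.bounded_on_compact (S.isCompact_homNorm_le 1)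
  refine ⟨max C 0, le_max_right _ _, fun z => ?_⟩
  rcases (S.homNorm_nonneg (fun _ => 1) z).eq_or_lt with h | h
  · rw [S.eq_zero_of_homNorm_eq_zero (fun _ _ _ => one_pos) h.symm, hp.map_zero, homNorm_zero,
      MulZeroClass.mul_zero]
  · set r := S.homNorm (fun _ => 1) z with hr
    have h1 : S.homNorm (fun _ => 1) (S.dil (1 / r) z) = 1 := by
      rw [homNorm_dil _ _ (by positivity), ← hr, one_div_mul_cancel h.ne']
    have h2 := hC (S.dil (1 / r) z) h1.le
    rw [hp.map_dil _ (by positivity), one_div, inv_mul_le_iff₀ h] at h2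
    calc p z ≤ r * C := h2
      _ ≤ max C 0 * r := by rw [mul_comm]; gcongr; exact le_max_left _ _

end BanachHomogeneousGroup

end PansuDiff

/-! ### Homogeneous distances and density points -/

namespace PansuDiff

namespace IsHomogeneousDist

variable {G : Type*} [NormedAddCommGroup G] [NormedSpace ℝ G] {S : StratifiedGroup G}
  {d : G → G → ℝ}

theorem dist_self (hd : IsHomogeneousDist S d) (x : G) : d x x = 0 := (hd.eq_zero_iff x x).mpr rfl

theorem nonneg (hd : IsHomogeneousDist S d) (x y : G) : 0 ≤ d x y := by
  have h := hd.triangle x y x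
  rw [hd.dist_self, hd.symm y x] at h
  linarith

theorem pos (hd : IsHomogeneousDist S d) {x y : G} (h : x ≠ y) : 0 < d x y :=
  (hd.nonneg x y).lt_of_ne fun h0 => h ((hd.eq_zero_iff x y).mp h0.symm)

theorem eq_dist_zero (hd : IsHomogeneousDist S d) (x y : G) :
    d x y = d (S.mul (S.inv x) y) 0 := by
  rw [← hd.mul_left (S.inv x) x y, S.inv_mul_self, hd.symm]

theorem isGauge (hd : IsHomogeneousDist S d) : S.IsGauge fun z => d z 0 where
  nonneg x := hd.nonneg x 0
  mul_le x y := by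
    have h := hd.mul_left x y 0
    rw [S.mul_zero] at h
    have h' := hd.triangle (S.mul x y) x 0
    rw [h] at h'
    linarith
  map_inv x := by
    rw [← hd.mul_left x, S.mul_inv_self, S.mul_zero, hd.symm]
  map_dil r hr x := by
    have h := hd.dil r hr x 0
    rwa [S.dil_zero_right] at h

theorem dist_dil_zero (hd : IsHomogeneousDist S d) {t : ℝ} (ht : 0 < t) (x : G) :
    d (S.dil t x) 0 = t * d x 0 := hd.isGauge.map_dil t ht x

/-- A homogeneous distance is continuous for the topology of the underlying vector space. -/
theorem continuous_right (hd : IsHomogeneousDist S d) (x : G) : Continuous fun y => d x y := by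
  have := S.finiteDimensional
  obtain ⟨C, hC0, hC⟩ := hd.isGauge.le_homNorm
  refine continuous_iff_continuousAt.mpr fun y => ?_
  rw [ContinuousAt, tendsto_iff_dist_tendsto_zero]
  have hg : Continuous fun y' => C * S.homNorm (fun _ => 1) (S.mul (S.inv y) y') :=
    continuous_const.mul ((S.continuous_homNorm _).comp
      (S.continuous_mul.comp (continuous_const.prodMk continuous_id)))
  have h0 : C * S.homNorm (fun _ => 1) (S.mul (S.inv y) y) = 0 := by
    rw [S.inv_mul_self, S.homNorm_zero, mul_zero]
  have ht := hg.tendsto y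
  rw [h0] at ht
  refine squeeze_zero (fun _ => dist_nonneg) (fun y' => ?_) ht
  rw [Real.dist_eq]
  refine le_trans ?_ (hC _)
  rw [← hd.eq_dist_zero, abs_le]
  have h1 := hd.triangle x y y'
  have h2 := hd.triangle x y' y
  rw [hd.symm y' y] at h2
  constructor <;> linarith

theorem continuous_left (hd : IsHomogeneousDist S d) (x : G) : Continuous fun y => d y x := by
  simpa only [hd.symm _ x] using hd.continuous_right x

theorem isOpen_ball (hd : IsHomogeneousDist S d) (x : G) (r : ℝ) : IsOpen {y | d x y < r} :=
  isOpen_lt (hd.continuous_right x) continuous_const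

/-- The reverse comparison: a homogeneous distance is continuous and positive on the compact unit
sphere of the homogeneous norm. -/
theorem homNorm_le (hd : IsHomogeneousDist S d) :
    ∃ C, 0 ≤ C ∧ ∀ z, S.homNorm (fun _ => 1) z ≤ C * d z 0 := by
  have := S.finiteDimensional
  have hK : IsCompact {z | S.homNorm (fun _ => 1) z = 1} :=
    (S.isCompact_homNorm_le 1).of_isClosed_subset
      (isClosed_eq (S.continuous_homNorm _) continuous_const) fun z hz => le_of_eq hz
  have hpos : ∀ z ∈ {z | S.homNorm (fun _ => 1) z = 1}, 0 < d z 0 := fun z hz => by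
    refine hd.pos fun h => ?_
    rw [h, Set.mem_ofPred_eq, S.homNorm_zero] at hz
    exact zero_ne_one hz
  obtain ⟨c, hc0, hc⟩ := hK.exists_forall_le' (hd.continuous_left 0).continuousOn hpos
  refine ⟨c⁻¹, by positivity, fun z => ?_⟩
  rcases (S.homNorm_nonneg (fun _ => 1) z).eq_or_lt with h | h
  · rw [← h]
    exact mul_nonneg (by positivity) (hd.nonneg z 0)
  · set r := S.homNorm (fun _ => 1) z with hr
    have h1 : S.homNorm (fun _ => 1) (S.dil (1 / r) z) = 1 := by
      rw [S.homNorm_dil _ (by positivity), ← hr, one_div_mul_cancel h.ne']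
    have h2 := hc _ h1
    rw [hd.dist_dil_zero (by positivity), one_div, le_inv_mul_iff₀ h] at h2
    rwa [le_inv_mul_iff₀ hc0, mul_comm]

theorem isCompact_closedBall (hd : IsHomogeneousDist S d) (R : ℝ) :
    IsCompact {z | d z 0 ≤ R} := by
  have := S.finiteDimensional
  obtain ⟨C, hC0, hC⟩ := hd.homNorm_le
  exact (S.isCompact_homNorm_le (C * R)).of_isClosed_subset
    (isClosed_le (hd.continuous_left 0) continuous_const)
    fun z hz => (hC z).trans (mul_le_mul_of_nonneg_left hz hC0)

theorem exists_finite_net (hd : IsHomogeneousDist S d) {K : Set G} (hK : IsCompact K) {ε : ℝ}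
    (hε : 0 < ε) : ∃ s : Finset G, (∀ g ∈ s, g ∈ K) ∧ ∀ z ∈ K, ∃ g ∈ s, d g z < ε := by
  obtain ⟨s, hs, hcov⟩ := hK.elim_nhds_subcover (fun g => {z | d g z < ε}) fun g _ =>
    (hd.isOpen_ball g ε).mem_nhds (by simpa [hd.dist_self] using hε)
  refine ⟨s, hs, fun z hz => ?_⟩
  simpa using hcov hz

end IsHomogeneousDist

namespace IsHHom

variable {G : Type*} [NormedAddCommGroup G] [NormedSpace ℝ G] {S : StratifiedGroup G}
  {M : Type*} [NormedAddCommGroup M] [NormedSpace ℝ M] {T : BanachHomogeneousGroup M}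
  {L : G → M}

theorem map_zero (hL : IsHHom S T L) : L 0 = 0 := by
  have h := hL.map_mul 0 0
  rw [S.mul_zero] at h
  have h' := T.inv_mul_cancel_left (L 0) (L 0)
  rw [← h, T.inv_mul_self] at h'
  exact h'.symm

theorem map_inv (hL : IsHHom S T L) (x : G) : L (S.inv x) = T.inv (L x) := by
  have h := hL.map_mul x (S.inv x)
  rw [S.mul_inv_self, hL.map_zero] at h
  rw [← T.inv_mul_cancel_left (L x) (L (S.inv x)), ← h, T.mul_zero]

/-- A homogeneous homomorphism is automatically Lipschitz, since its composition with the
homogeneous norm is a gauge. -/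
theorem exists_lipschitz (hL : IsHHom S T L) {d : G → G → ℝ} (hd : IsHomogeneousDist S d)
    {σ : ℕ → ℝ≥0} (hσ : T.IsHomNorm σ) :
    ∃ C, 0 ≤ C ∧ ∀ x y, T.homDist σ (L x) (L y) ≤ C * d x y := by
  have := S.finiteDimensional
  have hp : S.IsGauge fun z => T.homNorm σ (L z) :=
    { nonneg := fun x => T.homNorm_nonneg σ _
      mul_le := fun x y => by rw [hL.map_mul]; exact hσ.mul_le _ _
      map_inv := fun x => by rw [hL.map_inv, T.homNorm_inv]
      map_dil := fun r hr x => by rw [hL.map_dil r hr, T.homNorm_dil σ hr.le] }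
  obtain ⟨C, hC0, hC⟩ := hp.le_homNorm
  obtain ⟨C', hC0', hC'⟩ := hd.homNorm_le
  refine ⟨C * C', by positivity, fun x y => ?_⟩
  rw [BanachHomogeneousGroup.homDist, ← hL.map_inv, ← hL.map_mul, hd.eq_dist_zero, mul_assoc]
  exact (hC _).trans (mul_le_mul_of_nonneg_left (hC' _) hC0)

end IsHHom

section Measure

variable {G : Type*} [NormedAddCommGroup G] [NormedSpace ℝ G] {S : StratifiedGroup G}
  {d : G → G → ℝ} [MeasurableSpace G] [BorelSpace G] {μ : MeasureTheory.Measure G}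

theorem measure_ball_mul_left (hd : IsHomogeneousDist S d) (hμ : IsHaar S μ) (g x : G) (r : ℝ) :
    μ {y | d (S.mul g x) y < r} = μ {y | d x y < r} := by
  rw [← hμ.preimage_mul_left g _ (hd.isOpen_ball _ _).measurableSet]
  simp only [Set.mem_ofPred_eq, hd.mul_left]

theorem measure_ball_eq (hd : IsHomogeneousDist S d) (hμ : IsHaar S μ) (x x' : G) (r : ℝ) :
    μ {y | d x y < r} = μ {y | d x' y < r} := by
  have h := measure_ball_mul_left hd hμ x 0 r
  have h' := measure_ball_mul_left hd hμ x' 0 r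
  rw [S.mul_zero] at h h'
  rw [h, h']

theorem measure_ball_lt_top (hd : IsHomogeneousDist S d) (hμ : IsHaar S μ) (x : G) (r : ℝ) :
    μ {y | d x y < r} < ∞ := by
  rw [measure_ball_eq hd hμ x 0]
  refine (MeasureTheory.measure_mono fun y hy => ?_).trans_lt
    (hμ.finite_of_isCompact _ (hd.isCompact_closedBall r))
  rw [Set.mem_ofPred_eq, hd.symm]
  exact le_of_lt hy

/-- The doubling property: a finite net of the ball of radius `R` is transported to every scale
by dilations and translations. -/
theorem exists_measure_ball_le (hd : IsHomogeneousDist S d) (hμ : IsHaar S μ) (R : ℝ) {ε : ℝ}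
    (hε : 0 < ε) : ∃ N : ℕ, ∀ t, 0 < t → ∀ x x' : G,
      μ {y | d x y < R * t} ≤ N * μ {y | d x' y < ε * t} := by
  obtain ⟨s, -, hs⟩ := hd.exists_finite_net (hd.isCompact_closedBall R) hε
  refine ⟨s.card, fun t ht x x' => ?_⟩
  have hcov : {y | d x y < R * t} ⊆ ⋃ g ∈ s, {y | d (S.mul x (S.dil t g)) y < ε * t} := by
    intro y hy
    have hz : d (S.dil (1 / t) (S.mul (S.inv x) y)) 0 ≤ R := by
      rw [hd.dist_dil_zero (by positivity), ← hd.eq_dist_zero, one_div, inv_mul_le_iff₀ ht,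
        mul_comm]
      exact le_of_lt hy
    obtain ⟨g, hg, hgz⟩ := hs _ hz
    refine Set.mem_biUnion hg ?_
    have h := hd.dil t ht g (S.dil (1 / t) (S.mul (S.inv x) y))
    rw [S.dil_dil_div ht.ne', ← hd.mul_left x, S.mul_inv_cancel_left] at h
    rw [Set.mem_ofPred_eq, h, mul_comm]
    exact mul_lt_mul_of_pos_right hgz ht
  calc μ {y | d x y < R * t} ≤ μ (⋃ g ∈ s, {y | d (S.mul x (S.dil t g)) y < ε * t}) :=
        MeasureTheory.measure_mono hcov
    _ ≤ ∑ g ∈ s, μ {y | d (S.mul x (S.dil t g)) y < ε * t} :=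
        MeasureTheory.measure_biUnion_finset_le s _
    _ = s.card * μ {y | d x' y < ε * t} := by
        rw [Finset.sum_congr rfl fun g _ => measure_ball_eq hd hμ _ x' (ε * t), Finset.sum_const,
          nsmul_eq_mul]

/-- Near a density point, the distance from the points in a fixed direction to the set is small
compared with the scale: a missed ball would have a definite proportion of the measure. -/
theorem IsDensityPoint.eventually_exists_near (hd : IsHomogeneousDist S d) (hμ : IsHaar S μ)
    {A : Set G} {x : G} (hx : IsDensityPoint μ d A x) (ζ : G) {ε : ℝ} (hε : 0 < ε) :
    ∀ᶠ t : ℝ in 𝓝[>] 0, ∃ a, S.mul x a ∈ A ∧ d a (S.dil t ζ) < ε * t := by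
  set R := d ζ 0 + ε with hR
  have hRpos : 0 < R := add_pos_of_nonneg_of_pos (hd.nonneg _ _) hε
  obtain ⟨N, hN⟩ := exists_measure_ball_le hd hμ R hε
  have hscale : Filter.Tendsto (fun t : ℝ => R * t) (𝓝[>] 0) (𝓝[>] 0) := by
    refine tendsto_nhdsWithin_iff.mpr ⟨?_, ?_⟩
    · have : Filter.Tendsto (fun t : ℝ => R * t) (𝓝 0) (𝓝 (R * 0)) := Filter.tendsto_id.const_mul R
      rw [mul_zero] at this
      exact this.mono_left nhdsWithin_le_nhds
    · filter_upwards [self_mem_nhdsWithin] with t ht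
      exact mul_pos hRpos ht
  have hlt : 1 - (N : ℝ≥0∞)⁻¹ < 1 :=
    ENNReal.sub_lt_self ENNReal.one_ne_top one_ne_zero (by simp)
  filter_upwards [(hx.comp hscale).eventually_const_lt hlt, self_mem_nhdsWithin] with t ht ht0
  rw [Set.mem_Ioi] at ht0
  by_contra! hcon
  refine absurd ht (not_lt.mpr ?_)
  set B := {y | d x y < R * t} with hB
  set B' := {y | d (S.mul x (S.dil t ζ)) y < ε * t} with hB'
  have hsub : B' ⊆ B := fun y hy => by
    have h1 := hd.triangle x (S.mul x (S.dil t ζ)) y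
    have h2 := hd.mul_left x 0 (S.dil t ζ)
    rw [S.mul_zero, hd.symm 0, hd.dist_dil_zero ht0] at h2
    rw [Set.mem_ofPred_eq] at hy
    rw [hB, Set.mem_ofPred_eq, hR]
    linarith
  -- If no point of `A` is near `x δ_t ζ`, then `A` misses the ball `B'` inside `B`.
  have hdisj : A ∩ B ⊆ B \ B' := fun y hy => by
    refine ⟨hy.2, fun hy' => ?_⟩
    have h1 := hcon (S.mul (S.inv x) y) (by rw [S.mul_inv_cancel_left]; exact hy.1)
    rw [← hd.mul_left x, S.mul_inv_cancel_left, hd.symm] at h1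
    exact absurd hy' (not_lt.mpr h1)
  have hfin : ∀ z r, μ {y | d z y < r} ≠ ∞ := fun z r => (measure_ball_lt_top hd hμ z r).ne
  have hμB : (N : ℝ≥0∞)⁻¹ * μ B ≤ μ B' := by
    have h := hN t ht0 x (S.mul x (S.dil t ζ))
    rw [mul_comm, ← div_eq_mul_inv]
    exact ENNReal.div_le_of_le_mul' h
  change μ (A ∩ B) / μ B ≤ _
  refine ENNReal.div_le_of_le_mul ?_
  rw [ENNReal.sub_mul fun _ _ => hfin _ _, one_mul]
  calc μ (A ∩ B) ≤ μ (B \ B') := MeasureTheory.measure_mono hdisj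
    _ = μ B - μ B' := MeasureTheory.measure_sdiff hsub
        (hd.isOpen_ball _ _).measurableSet.nullMeasurableSet (hfin _ _)
    _ ≤ μ B - (N : ℝ≥0∞)⁻¹ * μ B := tsub_le_tsub_left hμB _

/-- At a density point every direction is approximated: take almost nearest points. -/
theorem IsDensityPoint.exists_approximates (hd : IsHomogeneousDist S d) (hμ : IsHaar S μ)
    {A : Set G} {x : G} (hxA : x ∈ A) (hx : IsDensityPoint μ d A x) (ζ : G) :
    ∃ c, Approximates S d A x ζ c := by
  have hnear : ∀ t : ℝ, ∃ a, S.mul x a ∈ A ∧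
      (0 < t → ∀ a', S.mul x a' ∈ A → d a (S.dil t ζ) ≤ d a' (S.dil t ζ) + t ^ 2) := by
    intro t
    by_cases ht : 0 < t
    · set D := (fun a => d a (S.dil t ζ)) '' {a | S.mul x a ∈ A} with hD
      have hne : D.Nonempty := ⟨_, 0, by simpa [S.mul_zero] using hxA, rfl⟩
      have hbd : BddBelow D := ⟨0, by rintro _ ⟨a, -, rfl⟩; exact hd.nonneg _ _⟩
      obtain ⟨_, ⟨a, ha, rfl⟩, hlt⟩ := exists_lt_of_csInf_lt hne
        (lt_add_of_pos_right (sInf D) (pow_pos ht 2))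
      exact ⟨a, ha, fun _ a' ha' =>
        hlt.le.trans (add_le_add_left (csInf_le hbd ⟨a', ha', rfl⟩) _)⟩
    · exact ⟨0, by rwa [S.mul_zero], fun h => absurd h ht⟩
  choose c hcA hc using hnear
  refine ⟨c, fun t _ => hcA t, ?_⟩
  rw [Metric.tendsto_nhds]
  intro ε hε
  have hsmall : ∀ᶠ t : ℝ in 𝓝[>] 0, t < ε / 2 :=
    nhdsWithin_le_nhds (Iio_mem_nhds (half_pos hε))
  filter_upwards [hx.eventually_exists_near hd hμ ζ (half_pos hε), hsmall,
    self_mem_nhdsWithin] with t ⟨a, haA, ha⟩ hts ht0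
  rw [Set.mem_Ioi] at ht0
  rw [Real.dist_eq, sub_zero, abs_of_nonneg (div_nonneg (hd.nonneg _ _) ht0.le), div_lt_iff₀ ht0]
  have h := hc t ht0 a haA
  nlinarith

end Measure

end PansuDiff

/-! ### Directional derivatives and h-differentiability -/

namespace PansuDiff

theorem tendsto_zero_iff_eventually_le {α : Type*} {l : Filter α} {g : α → ℝ}
    (hg : ∀ᶠ a in l, 0 ≤ g a) :
    Filter.Tendsto g l (𝓝 0) ↔ ∀ ε > 0, ∀ᶠ a in l, g a ≤ ε := by
  rw [Metric.tendsto_nhds]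
  refine ⟨fun h ε hε => ?_, fun h ε hε => ?_⟩
  · filter_upwards [h ε hε, hg] with a ha ha0
    rw [Real.dist_eq, sub_zero, abs_of_nonneg ha0] at ha
    exact ha.le
  · filter_upwards [h (ε / 2) (half_pos hε), hg] with a ha ha0
    rw [Real.dist_eq, sub_zero, abs_of_nonneg ha0]
    linarith

section Differentiability

variable {G : Type*} [NormedAddCommGroup G] [NormedSpace ℝ G] {S : StratifiedGroup G}
  {M : Type*} [NormedAddCommGroup M] [NormedSpace ℝ M] {T : BanachHomogeneousGroup M}
  {σ : ℕ → ℝ≥0} {d : G → G → ℝ} {A : Set G} {f : G → M} {x : G}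

/-- The defining limit of h-differentiability in terms of `ε` and `δ`. -/
theorem tendsto_hDiff_iff (L : G → M) :
    Filter.Tendsto
      (fun z : G => T.homDist σ (T.mul (T.inv (f x)) (f (S.mul x z))) (L z) / d z 0)
      (Filter.comap (fun z : G => d z 0) (𝓝[>] 0) ⊓ Filter.principal {z | S.mul x z ∈ A}) (𝓝 0) ↔
    ∀ ε > 0, ∃ δ > 0, ∀ z, 0 < d z 0 → d z 0 < δ → S.mul x z ∈ A →
      T.homDist σ (T.mul (T.inv (f x)) (f (S.mul x z))) (L z) ≤ ε * d z 0 := by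
  have hbasis := ((nhdsGT_basis (0 : ℝ)).comap fun z : G => d z 0).inf_principal
    {z | S.mul x z ∈ A}
  rw [tendsto_zero_iff_eventually_le]
  · refine forall₂_congr fun ε _ => ?_
    rw [hbasis.eventually_iff]
    refine exists_congr fun δ => and_congr_right fun _ => ?_
    constructor
    · intro h z hz0 hzδ hzA
      exact (div_le_iff₀ hz0).mp (h ⟨⟨hz0, hzδ⟩, hzA⟩)
    · rintro h z ⟨⟨hz0, hzδ⟩, hzA⟩
      exact (div_le_iff₀ hz0).mpr (h z hz0 hzδ hzA)
  · rw [hbasis.eventually_iff]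
    exact ⟨1, one_pos, fun z hz => div_nonneg (T.homDist_nonneg _ _) (le_of_lt hz.1.1)⟩

theorem tendsto_homDist_iff {u : ℝ → M} {v : M} :
    Filter.Tendsto (fun t : ℝ => T.homDist σ (u t) v) (𝓝[>] 0) (𝓝 0) ↔
      ∀ ε > 0, ∀ᶠ t in 𝓝[>] 0, T.homDist σ (u t) v ≤ ε :=
  tendsto_zero_iff_eventually_le (Filter.Eventually.of_forall fun _ => T.homDist_nonneg _ _)

theorem Approximates.eventually_le (hd : IsHomogeneousDist S d) {ζ : G} {c : ℝ → G}
    (hc : Approximates S d A x ζ c) {ε : ℝ} (hε : 0 < ε) :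
    ∀ᶠ t : ℝ in 𝓝[>] 0, d (c t) (S.dil t ζ) ≤ ε * t := by
  have h := (tendsto_zero_iff_eventually_le (l := 𝓝[>] (0 : ℝ)) (by
    filter_upwards [self_mem_nhdsWithin] with t ht
    exact div_nonneg (hd.nonneg _ _) (le_of_lt ht))).mp hc.2 ε hε
  filter_upwards [h, self_mem_nhdsWithin] with t ht ht0
  exact (div_le_iff₀ ht0).mp ht

theorem HasDirDeriv.unique (hσ : T.IsHomNorm σ) {ζ : G} {v v' : M}
    (h : HasDirDeriv S T σ d A f x ζ v) (h' : HasDirDeriv S T σ d A f x ζ v') : v = v' := by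
  obtain ⟨c, hc⟩ := h.1
  refine T.eq_of_homDist_eq_zero hσ (le_antisymm (le_of_forall_pos_le_add fun ε hε => ?_)
    (T.homDist_nonneg v v'))
  obtain ⟨t, h1, h2⟩ := ((tendsto_homDist_iff.mp (h.2 c hc) (ε / 2) (half_pos hε)).and
    (tendsto_homDist_iff.mp (h'.2 c hc) (ε / 2) (half_pos hε))).exists
  have h3 := T.homDist_triangle hσ v
    (T.dil (1 / t) (T.mul (T.inv (f x)) (f (S.mul x (c t))))) v'
  rw [T.homDist_comm v (T.dil _ _)] at h3
  linarith

theorem HasDirDeriv.dirDeriv_eq (hσ : T.IsHomNorm σ) {ζ : G} (hζ : ζ ≠ 0) {v : M}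
    (h : HasDirDeriv S T σ d A f x ζ v) : dirDeriv S T σ d A f x ζ = v := by
  have hex : ∃ v, HasDirDeriv S T σ d A f x ζ v := ⟨v, h⟩
  rw [dirDeriv, if_neg hζ, dif_pos hex]
  exact hex.choose_spec.unique hσ h

theorem hasDirDeriv_dirDeriv {ζ : G} (hζ : ζ ≠ 0)
    (h : ∃ v, HasDirDeriv S T σ d A f x ζ v) :
    HasDirDeriv S T σ d A f x ζ (dirDeriv S T σ d A f x ζ) := by
  rw [dirDeriv, if_neg hζ, dif_pos h]
  exact h.choose_spec

/-- If `L` is an h-differential, its values are the directional derivatives along every choice of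
approximating points, because `L` is Lipschitz. -/
theorem tendsto_of_hDiff (hd : IsHomogeneousDist S d) (hσ : T.IsHomNorm σ) {L : G → M}
    (hL : IsHHom S T L)
    (hdiff : ∀ ε > 0, ∃ δ > 0, ∀ z, 0 < d z 0 → d z 0 < δ → S.mul x z ∈ A →
      T.homDist σ (T.mul (T.inv (f x)) (f (S.mul x z))) (L z) ≤ ε * d z 0)
    {ζ : G} (hζ : ζ ≠ 0) {c : ℝ → G} (hc : Approximates S d A x ζ c) :
    Filter.Tendsto
      (fun t : ℝ => T.homDist σ (T.dil (1 / t) (T.mul (T.inv (f x)) (f (S.mul x (c t))))) (L ζ))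
      (𝓝[>] 0) (𝓝 0) := by
  obtain ⟨C, hC0, hC⟩ := hL.exists_lipschitz hd hσ
  refine tendsto_homDist_iff.mpr fun ε hε => ?_
  have hζpos : 0 < d ζ 0 := hd.pos hζ
  obtain ⟨δ, hδ, hdiff'⟩ := hdiff (ε / 2 / (2 * d ζ 0)) (by positivity)
  -- The first bound keeps `d (c t) 0` between `0` and `2 t d ζ 0`; the second controls `L`.
  set η := min (d ζ 0 / 2) (ε / 2 / (C + 1)) with hη
  have hη0 : 0 < η := lt_min (by positivity) (by positivity)
  have hsmall : ∀ᶠ t : ℝ in 𝓝[>] 0, t < δ / (2 * d ζ 0) :=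
    nhdsWithin_le_nhds (Iio_mem_nhds (by positivity))
  filter_upwards [hc.eventually_le hd hη0, hsmall, self_mem_nhdsWithin] with t hct hts ht0
  rw [Set.mem_Ioi] at ht0
  have hη1 : η * t ≤ d ζ 0 / 2 * t := mul_le_mul_of_nonneg_right (min_le_left _ _) ht0.le
  have hη2 : η * (C + 1) ≤ ε / 2 := (le_div_iff₀ (by positivity)).mp (min_le_right _ _)
  have h1 := hd.triangle (c t) (S.dil t ζ) 0
  have h2 := hd.triangle (S.dil t ζ) (c t) 0
  rw [hd.symm (S.dil t ζ) (c t)] at h2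
  rw [hd.dist_dil_zero ht0] at h1 h2
  have htpos : 0 < t * d ζ 0 := mul_pos ht0 hζpos
  have hlow : 0 < d (c t) 0 := by nlinarith
  have hup : d (c t) 0 ≤ 2 * d ζ 0 * t := by nlinarith
  rw [lt_div_iff₀ (by positivity)] at hts
  have h3 := hdiff' (c t) hlow (by linarith) (hc.1 t ht0)
  have h4 : ε / 2 / (2 * d ζ 0) * d (c t) 0 ≤ ε / 2 * t := by
    rw [div_mul_eq_mul_div, div_le_iff₀ (by positivity)]
    calc ε / 2 * d (c t) 0 ≤ ε / 2 * (2 * d ζ 0 * t) := by gcongr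
      _ = ε / 2 * t * (2 * d ζ 0) := by ring
  have h5 := (hC (c t) (S.dil t ζ)).trans (mul_le_mul_of_nonneg_left hct hC0)
  have h6 : C * (η * t) ≤ ε / 2 * t := by
    calc C * (η * t) ≤ η * (C + 1) * t := by nlinarith [mul_pos hη0 ht0]
      _ ≤ ε / 2 * t := mul_le_mul_of_nonneg_right hη2 ht0.le
  have h7 := T.homDist_triangle hσ (T.mul (T.inv (f x)) (f (S.mul x (c t)))) (L (c t))
    (L (S.dil t ζ))
  have h8 := T.homDist_dil (σ := σ) ht0.le
    (T.dil (1 / t) (T.mul (T.inv (f x)) (f (S.mul x (c t))))) (L ζ)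
  rw [T.dil_dil_div ht0.ne', ← hL.map_dil t ht0] at h8
  have h9 : t * T.homDist σ (T.dil (1 / t) (T.mul (T.inv (f x)) (f (S.mul x (c t))))) (L ζ) ≤
      t * ε := by
    rw [← h8]
    linarith
  exact le_of_mul_le_mul_left h9 ht0

/-- If all directional derivatives exist and form a homogeneous homomorphism `L`, then `L` is an
h-differential: finitely many directions form a net of the unit sphere, and the Lipschitz
property of `f` and `L` controls the error made by passing to the nearest one. -/
theorem hDiff_of_hasDirDeriv (hd : IsHomogeneousDist S d) (hσ : T.IsHomNorm σ)
    (hf : LipschitzOnSet T σ d A f) {L : G → M} (hL : IsHHom S T L)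
    (hdir : ∀ ζ, ζ ≠ 0 → HasDirDeriv S T σ d A f x ζ (L ζ)) (ε : ℝ) (hε : 0 < ε) :
    ∃ δ > 0, ∀ z, 0 < d z 0 → d z 0 < δ → S.mul x z ∈ A →
      T.homDist σ (T.mul (T.inv (f x)) (f (S.mul x z))) (L z) ≤ ε * d z 0 := by
  obtain ⟨C, hC0, hC⟩ := hL.exists_lipschitz hd hσ
  obtain ⟨C₁, hC₁⟩ := hf
  set C' := max C₁ 0 with hC'
  have hC'0 : 0 ≤ C' := le_max_right _ _
  have hfC : ∀ y ∈ A, ∀ y' ∈ A, T.homDist σ (f y) (f y') ≤ C' * d y y' := fun y hy y' hy' =>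
    (hC₁ y hy y' hy').trans (mul_le_mul_of_nonneg_right (le_max_left _ _) (hd.nonneg _ _))
  have hK : IsCompact {z | d z 0 = 1} := (hd.isCompact_closedBall 1).of_isClosed_subset
    (isClosed_eq (hd.continuous_left 0) continuous_const) fun z hz => le_of_eq hz
  -- The total error is at most `2 C' η + η + C η`.
  set η := ε / (2 * C' + C + 1) with hη
  have hη0 : 0 < η := by positivity
  obtain ⟨s, hsK, hs⟩ := hd.exists_finite_net hK hη0
  have hne : ∀ g ∈ s, g ≠ 0 := by
    rintro g hg rfl
    have h0 : d (0 : G) 0 = 1 := hsK 0 hg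
    rw [hd.dist_self] at h0
    exact zero_ne_one h0
  have hev : ∀ᶠ t : ℝ in 𝓝[>] 0, ∀ g ∈ s, ∃ a, S.mul x a ∈ A ∧ d a (S.dil t g) ≤ η * t ∧
      T.homDist σ (T.dil (1 / t) (T.mul (T.inv (f x)) (f (S.mul x a)))) (L g) ≤ η := by
    refine (Filter.eventually_all_finset s).mpr fun g hg => ?_
    obtain ⟨⟨c, hc⟩, hlim⟩ := hdir g (hne g hg)
    filter_upwards [hc.eventually_le hd hη0, tendsto_homDist_iff.mp (hlim c hc) η hη0,
      self_mem_nhdsWithin] with t h1 h2 ht0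
    exact ⟨c t, hc.1 t ht0, h1, h2⟩
  obtain ⟨δ, hδ, hδs⟩ := (nhdsGT_basis (0 : ℝ)).eventually_iff.mp hev
  refine ⟨δ, hδ, fun z hz0 hzδ hzA => ?_⟩
  set t := d z 0 with ht
  have hz1 : d (S.dil (1 / t) z) 0 = 1 := by
    rw [hd.dist_dil_zero (by positivity), ← ht, one_div_mul_cancel hz0.ne']
  obtain ⟨g, hg, hgz⟩ := hs _ hz1
  obtain ⟨a, haA, ha1, ha2⟩ := hδs ⟨hz0, hzδ⟩ g hg
  have hgz' : d (S.dil t g) z ≤ η * t := by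
    have h := hd.dil t hz0 g (S.dil (1 / t) z)
    rw [S.dil_dil_div hz0.ne'] at h
    rw [h, mul_comm]
    exact mul_le_mul_of_nonneg_right hgz.le hz0.le
  have h1 : T.homDist σ (T.mul (T.inv (f x)) (f (S.mul x z)))
      (T.mul (T.inv (f x)) (f (S.mul x a))) ≤ C' * (2 * η * t) := by
    rw [T.homDist_mul_left]
    refine (hfC _ hzA _ haA).trans (mul_le_mul_of_nonneg_left ?_ hC'0)
    rw [hd.mul_left]
    have h := hd.triangle z (S.dil t g) a
    rw [hd.symm z (S.dil t g), hd.symm (S.dil t g) a] at h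
    linarith
  have h2 : T.homDist σ (T.mul (T.inv (f x)) (f (S.mul x a))) (L (S.dil t g)) ≤ t * η := by
    have h := T.homDist_dil (σ := σ) hz0.le
      (T.dil (1 / t) (T.mul (T.inv (f x)) (f (S.mul x a)))) (L g)
    rw [T.dil_dil_div hz0.ne', ← hL.map_dil t hz0] at h
    rw [h]
    exact mul_le_mul_of_nonneg_left ha2 hz0.le
  have h3 : T.homDist σ (L (S.dil t g)) (L z) ≤ C * (η * t) :=
    (hC _ _).trans (mul_le_mul_of_nonneg_left hgz' hC0)
  have h4 := T.homDist_triangle hσ (T.mul (T.inv (f x)) (f (S.mul x z)))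
    (T.mul (T.inv (f x)) (f (S.mul x a))) (L z)
  have h5 := T.homDist_triangle hσ (T.mul (T.inv (f x)) (f (S.mul x a))) (L (S.dil t g)) (L z)
  have h6 : C' * (2 * η * t) + t * η + C * (η * t) = ε * t := by
    have : η * (2 * C' + C + 1) = ε := div_mul_cancel₀ _ (by positivity)
    rw [← this]
    ring
  linarith

end Differentiability

end PansuDiff

theorem mainTheorem2
    {G : Type*} [NormedAddCommGroup G] [NormedSpace ℝ G] [MeasurableSpace G] [BorelSpace G]
    {M : Type*} [NormedAddCommGroup M] [NormedSpace ℝ M]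
    (S : PansuDiff.StratifiedGroup G) (T : PansuDiff.BanachHomogeneousGroup M)
    (d : G → G → ℝ) (hd : PansuDiff.IsHomogeneousDist S d)
    (μ : MeasureTheory.Measure G) (hμ : PansuDiff.IsHaar S μ)
    (σ : ℕ → NNReal) (hσ : T.IsHomNorm σ)
    (A : Set G) (hA : MeasureTheory.NullMeasurableSet A μ)
    (f : G → M) (hf : PansuDiff.LipschitzOnSet T σ d A f)
    (x : G) (hxA : x ∈ A) (hx : PansuDiff.IsDensityPoint μ d A x) :
    PansuDiff.HDifferentiableAt S T σ d A f x ↔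
      (∀ ζ : G, ζ ≠ 0 → ∃ v : M, PansuDiff.HasDirDeriv S T σ d A f x ζ v) ∧
        PansuDiff.IsHHom S T (fun ζ : G => PansuDiff.dirDeriv S T σ d A f x ζ) := by
  constructor
  · rintro ⟨L, hL, hdiff⟩
    have hdir : ∀ ζ : G, ζ ≠ 0 → PansuDiff.HasDirDeriv S T σ d A f x ζ (L ζ) := fun ζ hζ =>
      ⟨hx.exists_approximates hd hμ hxA ζ, fun c hc =>
        PansuDiff.tendsto_of_hDiff hd hσ hL ((PansuDiff.tendsto_hDiff_iff L).mp hdiff) hζ hc⟩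
    refine ⟨fun ζ hζ => ⟨L ζ, hdir ζ hζ⟩, ?_⟩
    have heq : (fun ζ : G => PansuDiff.dirDeriv S T σ d A f x ζ) = L := by
      funext ζ
      by_cases hζ : ζ = 0
      · rw [hζ, hL.map_zero, PansuDiff.dirDeriv, if_pos rfl]
      · exact (hdir ζ hζ).dirDeriv_eq hσ hζ
    rw [heq]
    exact hL
  · rintro ⟨hex, hL⟩
    exact ⟨_, hL, (PansuDiff.tendsto_hDiff_iff _).mpr fun ε hε =>
      PansuDiff.hDiff_of_hasDirDeriv hd hσ hf hL
        (fun ζ hζ => PansuDiff.hasDirDeriv_dirDeriv hζ (hex ζ hζ)) ε hε⟩
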